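/- Let $K$ be a field of characteristic $0$ and let $\beta\in K$ not be a negative rational number (for instance $\beta\ge 0$ real, or $\beta$ an indeterminate and $K=\mathbb Q(\beta)$). Let $N\ge 0$, let $z_1,\dots,z_N$ be commuting variables, let $\theta_1,\dots,\theta_N$ be anticommuting variables ($\theta_i\theta_j=-\theta_j\theta_i$, $\theta_i^2=0$) that commute with the $z_i$, and let $$\bar{\mathcal H}=\sum_i (z_i\partial_{z_i})^2+\beta\sum_{i<j}\frac{z_i+z_j}{z_i-z_j}\,(z_i\partial_{z_i}-z_j\partial_{z_j})-2\beta\sum_{i<j}\frac{z_iz_j}{(z_i-z_j)^2}(1-\kappa_{ij}),\qquad \kappa_{ij}=1-(\theta_i-\theta_j)(\partial_{\theta_i}-\partial_{\theta_j}).$$ A superpartition $\Lambda=(\Lambda_1,\dots,\Lambda_m;\Lambda_{m+1},\dots,\Lambda_N)$, $0\le m\le N$, is a sequence of non-negative integers with $\Lambda_1>\dots>\Lambda_m$ and $\Lambda_{m+1}\ge\dots\ge\Lambda_N$; $\Lambda^*$ is the partition obtained by putting all its parts in decreasing order. Let $<$ be the strict dominance order on partitions of the same size. Put $$m_\Lambda=\frac1{f_\Lambda}\sum_{\sigma\in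 S_N}\mathcal K_\sigma(\theta_1\cdots\theta_m z_1^{\Lambda_1}\cdots z_N^{\Lambda_N}),\qquad f_\Lambda=\prod_{a\ge0}\#\{i>m:\Lambda_i=a\}!,$$ where $\mathcal K_\sigma$ sends $z_i\mapsto z_{\sigma(i)}$ and $\theta_i\mapsto\theta_{\sigma(i)}$, and put $$\varepsilon_\Lambda=\sum_{j=1}^N\left[(\Lambda^*_j)^2+\beta(N+1-2j)\Lambda^*_j\right].$$ For $i<j$ and an integer $\ell\ge0$ let $R_{ij}^{(\ell)}\Lambda$ be the sequence obtained from $\Lambda$ by moving $\ell$ units from the larger to the smaller of the entries $\Lambda_i,\Lambda_j$; this is allowed only if $\ell\le\lfloor(\Lambda_i-\Lambda_j-1)/2\rfloor$ when $i<j\le m$, $\ell\le|\Lambda_i-\Lambda_j|-1$ when $i\le m<j$, and $\ell\le\lfloor(\Lambda_i-\Lambda_j)/2\rfloor$ when $m<i<j$. Write $\Omega=\overline{\gamma}$ if $\Omega$ is a superpartition with the same $m$ whose parts before the semicolon rearrange $(\gamma_1,\dots,\gamma_m)$ and whose parts after it rearrange $(\gamma_{m+1},\dots,\gamma_N)$.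 Write $\Omega\le^s\Lambda$ if $\Omega$ is obtained from $\Lambda$ by a finite, possibly empty, sequence of allowed steps $\Gamma\mapsto\overline{R_{ij}^{(\ell)}\Gamma}$ between superpartitions, and $\Omega<^s\Lambda$ if moreover $\Omega\ne\Lambda$. Then for every superpartition $\Lambda$ there is a unique superpolynomial $\mathcal J_\Lambda$ in $z_1,\dots,z_N,\theta_1,\dots,\theta_N$ over $K$ such that $$\mathcal J_\Lambda=m_\Lambda+\sum_{\Omega;\ \Omega<^s\Lambda}c_{\Lambda\Omega}\,m_\Omega\ \text{ for some } c_{\Lambda\Omega}\in K,\qquad \bar{\mathcal H}\,\mathcal J_\Lambda=\varepsilon_\Lambda\,\mathcal J_\Lambda .$$ There is also a unique superpolynomial $\mathcal J_\Lambda$ such that $$\mathcal J_\Lambda=m_\Lambda+\sum_{\Omega;\ \Omega^*<\Lambda^*}c_{\Lambda\Omega}\,m_\Omega\ \text{ for some } c_{\Lambda\Omega}\in K,\qquad \bar{\mathcal H}\,\mathcal J_\Lambda=\varepsilon_\Lambda\,\mathcal J_\Lambda ,$$ which is the definition of the Jack superpolynomial. A superpolynomial satisfies the first pair of conditions if and only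 if it satisfies the second; so both pairs characterize the Jack superpolynomial. -/

import Mathlib

open scoped TensorProduct

/-- A superpartition with `N` parts
`Λ = (Λ_1, …, Λ_m ; Λ_{m+1}, …, Λ_N)` in the `m`-fermion sector (`0 ≤ m ≤ N`); the `N` parts are
indexed from `0`, so the parts before the semicolon are those with index `< m`. -/
@[ext]
structure SuperPartition (N : ℕ) where
  /-- The fermion number. -/
  m : ℕ
  m_le : m ≤ N
  /-- The sequence of parts. -/
  part : Fin N → ℕ
  /-- The parts before the semicolon are strictly decreasing. -/
  anti : ∀ i j : Fin N, i < j → (j : ℕ) < m → part j < part i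
  /-- The parts after the semicolon are weakly decreasing. -/
  symm : ∀ i j : Fin N, m ≤ (i : ℕ) → i < j → part j ≤ part i

namespace SuperPartition

variable {N : ℕ}

/-- The partition `Λ^*`: the parts of `Λ` in (weakly) decreasing order. -/
def star (Λ : SuperPartition N) : Fin N → ℕ :=
  fun i => Λ.part (Tuple.sort Λ.part (Fin.rev i))

/-- The dominance order `ω ≤ λ` on partitions with at most `N` parts: `ω` and `λ` have the same
size, and each partial sum of `ω` is at most that of `λ`. -/
def DominanceLE (ω lam : Fin N → ℕ) : Prop :=
  ∑ i, ω i = ∑ i, lam i ∧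
    ∀ k : Fin N, ∑ i ∈ Finset.Iic k, ω i ≤ ∑ i ∈ Finset.Iic k, lam i

/-- Strict dominance order. -/
def DominanceLT (ω lam : Fin N → ℕ) : Prop :=
  DominanceLE ω lam ∧ ω ≠ lam

/-- The operator `R_{ij}^{(ℓ)}` on sequences: it moves `ℓ` units from the larger to the smaller
one of the `i`-th and `j`-th entries. It is only used for `ℓ ≤ |γ_i - γ_j|`
(see `Admissible`), so that the subtraction is a true one. -/
def lower (i j : Fin N) (l : ℕ) (γ : Fin N → ℕ) : Fin N → ℕ :=
  if γ j < γ i then Function.update (Function.update γ i (γ i - l)) j (γ j + l)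
  else if γ i < γ j then Function.update (Function.update γ i (γ i + l)) j (γ j - l)
  else γ

/-- The cases I, II, III in which `R_{ij}^{(ℓ)}` does not annihilate `Λ`.
Division on `ℤ` by `2` rounds down. -/
def Admissible (Λ : SuperPartition N) (i j : Fin N) (l : ℕ) : Prop :=
  i < j ∧
    (((j : ℕ) < Λ.m ∧ (l : ℤ) ≤ ((Λ.part i : ℤ) - Λ.part j - 1) / 2) ∨
     ((i : ℕ) < Λ.m ∧ Λ.m ≤ (j : ℕ) ∧ (l : ℤ) ≤ |(Λ.part i : ℤ) - Λ.part j| - 1) ∨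
     (Λ.m ≤ (i : ℕ) ∧ (l : ℤ) ≤ ((Λ.part i : ℤ) - Λ.part j) / 2))

/-- `Ω = \overline{γ}` in the `m`-fermion sector: the parts of the superpartition `Ω` before the
semicolon are a rearrangement of the first `m` entries of `γ`, and those after the semicolon are a
rearrangement of the other entries. (If two of the first `m` entries of `γ` are equal, there is no
such `Ω`.) -/
def IsRearrangement (Ω : SuperPartition N) (m : ℕ) (γ : Fin N → ℕ) : Prop :=
  Ω.m = m ∧ ∃ σ : Equiv.Perm (Fin N),
    (∀ i, (σ i : ℕ) < m ↔ (i : ℕ) < m) ∧ ∀ i, Ω.part i = γ (σ i)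

/-- `Ω = \overline{R_{ij}^{(ℓ)} Λ}` for some `i < j` and `ℓ ≥ 0` for which the operator does not
annihilate `Λ`. -/
def Step (Λ Ω : SuperPartition N) : Prop :=
  ∃ (i j : Fin N) (l : ℕ), Λ.Admissible i j l ∧ Ω.IsRearrangement Λ.m (lower i j l Λ.part)

/-- The order `Ω ≤^s Λ` on superpartitions: `Ω` is obtained from `Λ` by a finite (possibly empty)
sequence of steps. -/
def SLE (Ω Λ : SuperPartition N) : Prop :=
  Relation.ReflTransGen Step Λ Ω

/-- `Ω <^s Λ`. -/
def SLT (Ω Λ : SuperPartition N) : Prop :=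
  SLE Ω Λ ∧ Ω ≠ Λ

/-- `n_{λ^s}(a)`: the number of parts of `Λ` after the semicolon that are equal to `a`. -/
def symMult (Λ : SuperPartition N) (a : ℕ) : ℕ :=
  (Finset.univ.filter fun i : Fin N => Λ.m ≤ (i : ℕ) ∧ Λ.part i = a).card

/-- `f_Λ = n_{λ^s}(0)! n_{λ^s}(1)! n_{λ^s}(2)! ⋯`; the factors for numbers that are not parts of
`Λ` are `0! = 1` and left out. -/
def normalization (Λ : SuperPartition N) : ℕ :=
  ∏ a ∈ Finset.univ.image Λ.part, (Λ.symMult a).factorial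

/-- `ε_Λ = ∑_{j=1}^N [(Λ^*_j)^2 + β (N + 1 - 2 j) Λ^*_j]`. -/
def eigenvalue {K : Type*} [Field K] (β : K) (Λ : SuperPartition N) : K :=
  ∑ j : Fin N, ((Λ.star j : K) ^ 2
    + β * ((N : K) + 1 - 2 * (((j : ℕ) : K) + 1)) * (Λ.star j : K))

end SuperPartition

noncomputable section

namespace SuperPoly

variable (K : Type*) [Field K] (N : ℕ)

/-- The polynomials in the commuting variables `z_1, …, z_N`. -/
abbrev Bos := MvPolynomial (Fin N) K

/-- The rational functions in `z_1, …, z_N`. -/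
abbrev BosFrac := FractionRing (MvPolynomial (Fin N) K)

/-- The Grassmann algebra generated by the anticommuting variables `θ_1, …, θ_N`. -/
abbrev Ferm := ExteriorAlgebra K (Fin N → K)

/-- Superpolynomials in `z_1, …, z_N` and `θ_1, …, θ_N`. -/
abbrev SPoly := Bos K N ⊗[K] Ferm K N

/-- Superfunctions whose coefficients are rational functions of `z_1, …, z_N`. -/
abbrev SRat := BosFrac K N ⊗[K] Ferm K N

variable {K N}

/-- The anticommuting variable `θ_i`. -/
def θ (i : Fin N) : Ferm K N := ExteriorAlgebra.ι K (Pi.single i 1)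

/-- The (left) derivative `∂_{θ_i}`. -/
def dθ (i : Fin N) : Ferm K N →ₗ[K] Ferm K N :=
  CliffordAlgebra.contractLeft (LinearMap.proj i : (Fin N → K) →ₗ[K] K)

/-- `κ_{ij} = 1 - (θ_i - θ_j)(∂_{θ_i} - ∂_{θ_j})`. -/
def kappa (i j : Fin N) : Ferm K N →ₗ[K] Ferm K N :=
  LinearMap.id - LinearMap.mulLeft K (θ i - θ j) ∘ₗ (dθ i - dθ j)

/-- The operator `z_i ∂_{z_i}`. -/
def euler (i : Fin N) : Bos K N →ₗ[K] Bos K N :=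
  LinearMap.mulLeft K (MvPolynomial.X i) ∘ₗ (MvPolynomial.pderiv i).toLinearMap

/-- The inclusion of the polynomials into the rational functions. -/
def toFrac : Bos K N →ₗ[K] BosFrac K N :=
  (IsScalarTower.toAlgHom K (Bos K N) (BosFrac K N)).toLinearMap

/-- The variable `z_i` as a rational function. -/
def z (i : Fin N) : BosFrac K N := toFrac (MvPolynomial.X i)

/-- The inclusion of the superpolynomials into the superfunctions with rational coefficients. -/
def incl : SPoly K N →ₗ[K] SRat K N := TensorProduct.map toFrac LinearMap.id

/-- `(z_i ∂_i)^2`. -/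
def termA (i : Fin N) : SPoly K N →ₗ[K] SRat K N :=
  TensorProduct.map (toFrac ∘ₗ euler i ∘ₗ euler i) LinearMap.id

/-- `((z_i + z_j) / (z_i - z_j)) (z_i ∂_i - z_j ∂_j)`. -/
def termB (i j : Fin N) : SPoly K N →ₗ[K] SRat K N :=
  TensorProduct.map
    (LinearMap.mulLeft K ((z i + z j) / (z i - z j)) ∘ₗ toFrac ∘ₗ (euler i - euler j))
    LinearMap.id

/-- `(z_i z_j / (z_i - z_j)^2) (1 - κ_{ij})`. -/
def termF (i j : Fin N) : SPoly K N →ₗ[K] SRat K N :=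
  TensorProduct.map
    (LinearMap.mulLeft K (z i * z j / (z i - z j) ^ 2) ∘ₗ toFrac)
    (LinearMap.id - kappa i j)

/-- The Hamiltonian
`∑_i (z_i ∂_i)^2 + β ∑_{i<j} ((z_i + z_j) / (z_i - z_j)) (z_i ∂_i - z_j ∂_j)
  - 2 β ∑_{i<j} (z_i z_j / (z_i - z_j)^2) (1 - κ_{ij})`,
on superpolynomials. Its values have rational coefficients in general, because of the
denominators. -/
def hamiltonian (β : K) : SPoly K N →ₗ[K] SRat K N :=
  ∑ i, termA i + β • ∑ i, ∑ j ∈ Finset.Ioi i, termB i j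
    - (2 * β) • ∑ i, ∑ j ∈ Finset.Ioi i, termF i j

/-- The operator `𝒦_σ`, which permutes the `z_i` and the `θ_i` simultaneously:
`z_i ↦ z_{σ(i)}`, `θ_i ↦ θ_{σ(i)}`. -/
def exchange (σ : Equiv.Perm (Fin N)) : SPoly K N →ₗ[K] SPoly K N :=
  TensorProduct.map (MvPolynomial.rename σ).toLinearMap
    (ExteriorAlgebra.map (LinearMap.funLeft K K σ.symm)).toLinearMap

/-- `θ_1 ⋯ θ_m z^Λ`. -/
def leadingTerm (K : Type*) [Field K] {N : ℕ} (Λ : SuperPartition N) : SPoly K N :=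
  (∏ i, MvPolynomial.X i ^ Λ.part i) ⊗ₜ[K]
    (List.ofFn fun k : Fin Λ.m => (θ (Fin.castLE Λ.m_le k) : Ferm K N)).prod

/-- The monomial symmetric superpolynomial
`m_Λ = (1 / f_Λ) ∑_{σ ∈ S_N} 𝒦_σ (θ_1 ⋯ θ_m z^Λ)`. -/
def monomial (K : Type*) [Field K] {N : ℕ} (Λ : SuperPartition N) : SPoly K N :=
  (Λ.normalization : K)⁻¹ • ∑ σ : Equiv.Perm (Fin N), exchange σ (leadingTerm K Λ)

/-- `H J = ε_Λ J`. -/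
def IsEigen (β : K) (Λ : SuperPartition N) (J : SPoly K N) : Prop :=
  hamiltonian β J = Λ.eigenvalue β • incl J

/-- `J = m_Λ + ∑_{Ω : Ω^* < Λ^*} c_Ω m_Ω` and `H J = ε_Λ J`. -/
def IsJackDominance (β : K) (Λ : SuperPartition N) (J : SPoly K N) : Prop :=
  J - monomial K Λ ∈ Submodule.span K
      {g | ∃ Ω : SuperPartition N, SuperPartition.DominanceLT Ω.star Λ.star ∧ g = monomial K Ω} ∧
    IsEigen β Λ J

/-- `J = m_Λ + ∑_{Ω <^s Λ} c_Ω m_Ω` and `H J = ε_Λ J`. -/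
def IsJackS (β : K) (Λ : SuperPartition N) (J : SPoly K N) : Prop :=
  J - monomial K Λ ∈ Submodule.span K
      {g | ∃ Ω : SuperPartition N, Ω.SLT Λ ∧ g = monomial K Ω} ∧
    IsEigen β Λ J

end SuperPoly

end

/-! The heart of the matter is that the Hamiltonian is triangular on monomial superpolynomials for
the fine order: `hamiltonian_monomial` gives `H m_Λ = ε_Λ m_Λ` plus a combination of `m_Ω` with `Ω
<^s Λ`. On a symmetrized monomial, the interaction of the variables `i, j` divides exactly by `(z_i
- z_j)^2` (`pairNumerator_add_exchange`), and the quotient `spread` is a combination of the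
monomials obtained by moving `l` units between the two exponents, `0 ≤ l < |γ_i - γ_j|`. The term `l
= 0` yields the eigenvalue; the others are, up to sign and rearrangement, either zero or reached by
an allowed step (`symmetrize_lower_mem`).

An allowed step either fixes `Λ` or strictly lowers `Λ^*` in dominance order (`SLT.dominanceLT`).
Strict dominance separates eigenvalues: `ε_Λ - ε_Ω = a + β b` with integers `a > 0` and `b ≥ 0`,
nonzero unless `β` is a negative rational (`eigenvalue_ne`).

Hence `H - ε_Λ` can be inverted on the span of the `m_Ω` with `Ω <^s Λ`, which gives existence for
the stronger triangularity, and it is injective on the larger span given by dominance, which gives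
uniqueness for the weaker one. Together these make the two characterizations equivalent. -/

namespace SuperPartition

/-! ### Dominance order and sums of squares. -/

variable {N : ℕ}

/-- Abel summation: the sum of a decreasing sequence against a sequence of total `0` with
nonnegative partial sums is nonnegative. -/
lemma last_mul_sum_le_sum_mul {n : ℕ} (c d : Fin (n + 1) → ℤ) (hc : Antitone c)
    (hd : ∀ k, 0 ≤ ∑ i ∈ Finset.Iic k, d i) : c (Fin.last n) * ∑ i, d i ≤ ∑ i, c i * d i := by
  induction n with
  | zero => simp
  | succ n ih =>
    have h1 := ih (fun i => c i.castSucc) (fun i => d i.castSucc)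
      (fun a b hab => hc (Fin.castSucc_le_castSucc_iff.2 hab)) (fun k => by
        have := hd k.castSucc
        rwa [← Fin.map_castSuccEmb_Iic, Finset.sum_map] at this)
    have h2 := hd (Fin.last n).castSucc
    rw [← Fin.map_castSuccEmb_Iic, Finset.sum_map] at h2
    have h3 : Finset.Iic (Fin.last n) = Finset.univ := by
      ext x; simp [Fin.le_last]
    rw [h3] at h2
    have h4 : c (Fin.last (n + 1)) ≤ c (Fin.last n).castSucc := hc (Fin.le_last _)
    rw [Fin.sum_univ_castSucc, Fin.sum_univ_castSucc (n := n + 1) (f := fun i => c i * d i)]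
    simp only [Fin.coe_castSuccEmb] at h2
    have := mul_le_mul_of_nonneg_right h4 h2
    linarith

lemma sum_mul_nonneg (c d : Fin N → ℤ) (hc : Antitone c)
    (hd : ∀ k, 0 ≤ ∑ i ∈ Finset.Iic k, d i) (h0 : ∑ i, d i = 0) : 0 ≤ ∑ i, c i * d i := by
  cases N with
  | zero => simp
  | succ n => simpa [h0] using last_mul_sum_le_sum_mul c d hc hd

/-- Used with two weights: `c = ω`, to compare sums of squares, and `c_j = N + 1 - 2j`, to compare
the coefficients of `β` in the eigenvalues. -/
lemma DominanceLE.sum_mul_le {ω lam : Fin N → ℕ} (h : DominanceLE ω lam) (c : Fin N → ℤ)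
    (hc : Antitone c) : ∑ i, c i * ω i ≤ ∑ i, c i * lam i := by
  have := sum_mul_nonneg c (fun i => (lam i : ℤ) - ω i) hc
    (fun k => by
      rw [Finset.sum_sub_distrib, sub_nonneg]; exact_mod_cast h.2 k)
    (by rw [Finset.sum_sub_distrib, sub_eq_zero]; exact_mod_cast h.1.symm)
  simp only [mul_sub, Finset.sum_sub_distrib] at this
  linarith

/-- Abel summation gives `∑ ω² ≤ ∑ ω·lam`, so `0 < ∑ (lam - ω)² ≤ ∑ lam² - ∑ ω²`. The sum of squares
later serves as the rank for inductions. -/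
lemma DominanceLT.sum_sq_lt {ω lam : Fin N → ℕ} (h : DominanceLT ω lam) (hω : Antitone ω) :
    ∑ i, ω i ^ 2 < ∑ i, lam i ^ 2 := by
  have h1 := h.1.sum_mul_le (fun i => (ω i : ℤ)) (fun _ _ hab => Int.ofNat_le.2 (hω hab))
  have h2 : 0 < ∑ i, ((lam i : ℤ) - ω i) ^ 2 := by
    obtain ⟨i, hi⟩ := Function.ne_iff.1 h.2
    refine Finset.sum_pos' (fun i _ => sq_nonneg _) ⟨i, Finset.mem_univ i, ?_⟩
    have : (lam i : ℤ) - ω i ≠ 0 := by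
      rw [sub_ne_zero]; exact_mod_cast hi.symm
    positivity
  have h3 : ∑ i, ((lam i : ℤ) - ω i) ^ 2
      = ∑ i, (lam i : ℤ) ^ 2 - 2 * ∑ i, (ω i : ℤ) * lam i + ∑ i, (ω i : ℤ) * ω i := by
    rw [Finset.mul_sum, ← Finset.sum_sub_distrib, ← Finset.sum_add_distrib]
    exact Finset.sum_congr rfl fun i _ => by ring
  have h4 : ∑ i, (ω i : ℤ) * ω i = ∑ i, (ω i : ℤ) ^ 2 :=
    Finset.sum_congr rfl fun i _ => by ring
  have : ∑ i, (ω i : ℤ) ^ 2 < ∑ i, (lam i : ℤ) ^ 2 := by linarith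
  exact_mod_cast this

/-- The permutation that sorts the parts of `Λ` in decreasing order. -/
def starPerm (Λ : SuperPartition N) : Equiv.Perm (Fin N) :=
  Fin.revPerm.trans (Tuple.sort Λ.part)

lemma star_eq (Λ : SuperPartition N) : Λ.star = Λ.part ∘ Λ.starPerm := rfl

lemma star_antitone (Λ : SuperPartition N) : Antitone Λ.star := fun _ _ hab =>
  Tuple.monotone_sort Λ.part (Fin.rev_le_rev.2 hab)

lemma sum_star {M : Type*} [AddCommMonoid M] (Λ : SuperPartition N) (f : ℕ → M) :
    ∑ i, f (Λ.star i) = ∑ i, f (Λ.part i) := by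
  rw [star_eq]
  exact Equiv.sum_comp Λ.starPerm fun i => f (Λ.part i)

/-! ### Moving units between two parts lowers the dominance order. -/

lemma DominanceLE.trans {a b c : Fin N → ℕ} (h : DominanceLE a b) (h' : DominanceLE b c) :
    DominanceLE a c :=
  ⟨h.1.trans h'.1, fun k => (h.2 k).trans (h'.2 k)⟩

/-- A sum of `k` entries is at most `k t + ∑ (g i - t)` with truncated subtraction, with equality
for the `k` largest entries of `f` when `t` is the `k`-th. The criterion is symmetric in the
entries, so it ignores rearrangements. -/
lemma dominanceLE_of_sum_tsub_le {g f : Fin N → ℕ} (hf : Antitone f)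
    (h0 : ∑ i, g i = ∑ i, f i) (h : ∀ t, ∑ i, (g i - t) ≤ ∑ i, (f i - t)) :
    DominanceLE g f := by
  refine ⟨h0, fun k => ?_⟩
  have h1 : ∑ i ∈ Finset.Iic k, g i ≤ ∑ i ∈ Finset.Iic k, (f k + (g i - f k)) :=
    Finset.sum_le_sum fun i _ => by omega
  have h2 : ∑ i ∈ Finset.Iic k, (g i - f k) ≤ ∑ i, (g i - f k) :=
    Finset.sum_le_sum_of_subset (Finset.subset_univ _)
  have h3 : ∑ i, (f i - f k) = ∑ i ∈ Finset.Iic k, (f i - f k) := by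
    symm
    apply Finset.sum_subset (Finset.subset_univ _)
    intro i _ hi
    have := hf (le_of_lt (not_le.1 (by simpa using hi)) : k ≤ i)
    omega
  have h4 : ∑ i ∈ Finset.Iic k, f i = ∑ i ∈ Finset.Iic k, (f k + (f i - f k)) :=
    Finset.sum_congr rfl fun i hi => by
      have := hf (Finset.mem_Iic.1 hi)
      omega
  rw [Finset.sum_add_distrib] at h1 h4
  have := h (f k)
  omega

lemma sum_update_update {M : Type*} [AddCommMonoid M] {i j : Fin N} (h : i ≠ j)
    (γ : Fin N → ℕ) (a b : ℕ) (f : ℕ → M) :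
    ∑ k, f (Function.update (Function.update γ i a) j b k)
      = f a + f b + ∑ k ∈ (Finset.univ.erase i).erase j, f (γ k) := by
  rw [← Finset.add_sum_erase _ _ (Finset.mem_univ i),
    ← Finset.add_sum_erase (Finset.univ.erase i) _ (Finset.mem_erase.2 ⟨h.symm, Finset.mem_univ j⟩),
    ← add_assoc]
  congr 1
  · simp [Function.update_of_ne h]
  · refine Finset.sum_congr rfl fun k hk => ?_
    simp only [Finset.mem_erase] at hk
    rw [Function.update_of_ne hk.1, Function.update_of_ne hk.2.1]

/-- Here `a` is the larger and `b` the smaller of the two entries, which removes the case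
distinction in `lower`. -/
lemma sum_lower_lt_gt {i j : Fin N} (h : i ≠ j) {γ : Fin N → ℕ} {l : ℕ}
    (hl : l < Nat.dist (γ i) (γ j)) :
    ∃ a b : ℕ, l < a - b ∧
      (∀ f : ℕ → ℕ, ∃ R, ∑ k, f (γ k) = f a + f b + R ∧
        ∑ k, f (lower i j l γ k) = f (a - l) + f (b + l) + R) := by
  have hid : Function.update (Function.update γ i (γ i)) j (γ j) = γ := by simp
  rcases lt_trichotomy (γ j) (γ i) with hlt | heq | hlt
  · refine ⟨γ i, γ j, ?_, fun f => ⟨∑ k ∈ (Finset.univ.erase i).erase j, f (γ k), ?_, ?_⟩⟩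
    · rwa [Nat.dist_eq_sub_of_le_right hlt.le] at hl
    · rw [← sum_update_update h γ, hid]
    · rw [lower, if_pos hlt, sum_update_update h γ]
  · simp [heq] at hl
  · refine ⟨γ j, γ i, ?_, fun f => ⟨∑ k ∈ (Finset.univ.erase i).erase j, f (γ k), ?_, ?_⟩⟩
    · rwa [Nat.dist_eq_sub_of_le hlt.le] at hl
    · rw [add_comm (f (γ j)), ← sum_update_update h γ, hid]
    · rw [lower, if_neg hlt.le.not_gt, if_pos hlt, sum_update_update h γ,
        add_comm (f (γ j - l))]

/-- Convexity of `x ↦ max (x - t) 0` gives dominance; strict convexity of the square gives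
strictness. -/
lemma dominanceLT_of_lower {Λ Ω : SuperPartition N} {i j : Fin N} (h : i ≠ j) {l : ℕ}
    (hl0 : 0 < l) (hl : l < Nat.dist (Λ.part i) (Λ.part j)) {σ : Equiv.Perm (Fin N)}
    (hΩ : ∀ k, Ω.part k = lower i j l Λ.part (σ k)) : DominanceLT Ω.star Λ.star := by
  obtain ⟨a, b, hab, hf⟩ := sum_lower_lt_gt h hl
  have hsum : ∀ f : ℕ → ℕ, ∑ k, f (Ω.star k) = ∑ k, f (lower i j l Λ.part k) := fun f => by
    rw [sum_star]
    simp only [hΩ]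
    exact Equiv.sum_comp σ fun k => f (lower i j l Λ.part k)
  refine ⟨dominanceLE_of_sum_tsub_le Λ.star_antitone ?_ fun t => ?_, fun heq => ?_⟩
  · obtain ⟨R, h1, h2⟩ := hf id
    have h3 := hsum id
    have h4 := Λ.sum_star id
    simp only [id] at *
    omega
  · obtain ⟨R, h1, h2⟩ := hf fun x => x - t
    have h3 := hsum fun x => x - t
    have h4 := Λ.sum_star fun x => x - t
    rw [h3, h4, h1, h2]
    omega
  · obtain ⟨R, h1, h2⟩ := hf fun x => x ^ 2
    have h3 := hsum fun x => x ^ 2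
    have h4 := Λ.sum_star fun x => x ^ 2
    rw [heq] at h3
    -- The sum of squares drops by `2l(a - b - l) = 2l(1 + n) > 0`.
    obtain ⟨n, rfl⟩ : ∃ n, a = b + l + 1 + n := ⟨a - (b + l + 1), by omega⟩
    have e : b + l + 1 + n - l = b + 1 + n := by omega
    simp only [e] at *
    have h5 : (b + l + 1 + n) ^ 2 + b ^ 2 = (b + 1 + n) ^ 2 + (b + l) ^ 2 := by omega
    have : 0 < l * (1 + n) := by positivity
    nlinarith

/-! ### Sorting a sequence within its two blocks. -/

/-- The sorting key for superpartitions in the `m`-fermion sector. -/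
def sortKey (m : ℕ) (γ : Fin N → ℕ) (i : Fin N) : Bool ×ₗ ℕᵒᵈ :=
  toLex (decide (m ≤ (i : ℕ)), OrderDual.toDual (γ i))

lemma sortKey_comp {m : ℕ} {γ : Fin N → ℕ} {σ : Equiv.Perm (Fin N)}
    (hσ : ∀ i, (σ i : ℕ) < m ↔ (i : ℕ) < m) : sortKey m γ ∘ σ = sortKey m (γ ∘ σ) := by
  ext i
  have : m ≤ (σ i : ℕ) ↔ m ≤ (i : ℕ) := by rw [← not_lt, hσ, not_lt]
  simp only [Function.comp_apply, sortKey, this]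

lemma sortKey_le_iff {m : ℕ} {γ : Fin N → ℕ} {i j : Fin N} (h : i ≤ j)
    (hij : (j : ℕ) < m ∨ m ≤ (i : ℕ)) : sortKey m γ i ≤ sortKey m γ j ↔ γ j ≤ γ i := by
  have h' : (i : ℕ) ≤ j := h
  have : (m ≤ (i : ℕ)) = (m ≤ (j : ℕ)) := by
    apply propext; omega
  simp only [sortKey, Prod.Lex.toLex_le_toLex, this, lt_irrefl, false_or, true_and,
    OrderDual.toDual_le_toDual]

lemma sortKey_le_of_lt_of_le {m : ℕ} {γ : Fin N → ℕ} {i j : Fin N} (hi : (i : ℕ) < m)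
    (hj : m ≤ (j : ℕ)) : sortKey m γ i ≤ sortKey m γ j := by
  rw [sortKey, sortKey, Prod.Lex.toLex_le_toLex]
  left
  simp [hi, hj, Bool.lt_iff]

lemma sortKey_monotone (Λ : SuperPartition N) : Monotone (sortKey Λ.m Λ.part) := by
  intro i j hij
  rcases hij.eq_or_lt with rfl | hlt
  · rfl
  by_cases hj : (j : ℕ) < Λ.m
  · exact (sortKey_le_iff hij (Or.inl hj)).2 (Λ.anti i j hlt hj).le
  · by_cases hi : (i : ℕ) < Λ.m
    · exact sortKey_le_of_lt_of_le hi (not_lt.1 hj)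
    · exact (sortKey_le_iff hij (Or.inr (not_lt.1 hi))).2 (Λ.symm i j (not_lt.1 hi) hlt)

/-- The keys of `Λ` and `Ω` are both monotone and rearrange each other; a sequence has only one
monotone rearrangement. -/
lemma ext_of_isRearrangement {Λ Ω : SuperPartition N} (h : Ω.IsRearrangement Λ.m Λ.part) :
    Ω = Λ := by
  obtain ⟨hm, σ, hσ, hp⟩ := h
  have hp' : Ω.part = Λ.part ∘ σ := funext hp
  have h1 := Ω.sortKey_monotone
  rw [hm, hp', ← sortKey_comp hσ, ← Tuple.comp_sort_eq_comp_iff_monotone] at h1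
  have h2 := Λ.sortKey_monotone
  rw [← Function.comp_id (sortKey Λ.m Λ.part), ← Equiv.coe_refl,
    ← Tuple.comp_sort_eq_comp_iff_monotone, ← h1, sortKey_comp hσ] at h2
  ext i
  · exact hm
  · have := congrFun h2 i
    have := congrArg (fun x => OrderDual.ofDual (ofLex x).2) this
    simpa [sortKey, hp] using this.symm

/-- A sequence whose first `m` entries are distinct can be rearranged to a superpartition. -/
lemma exists_isRearrangement {m : ℕ} (hm : m ≤ N) (γ : Fin N → ℕ)
    (hγ : ∀ i j : Fin N, i < j → (j : ℕ) < m → γ i ≠ γ j) :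
    ∃ Ω : SuperPartition N, Ω.IsRearrangement m γ := by
  set σ := Tuple.sort (sortKey m γ) with hσdef
  have hmono : Monotone (sortKey m γ ∘ σ) := Tuple.monotone_sort _
  -- The block indicator is monotone both before and after sorting, so the two agree: the sorting
  -- permutation preserves the blocks.
  have hbool : ∀ i, decide (m ≤ (σ i : ℕ)) = decide (m ≤ (i : ℕ)) := by
    have hb : Monotone fun i : Fin N => decide (m ≤ (i : ℕ)) := by
      intro i j hij
      have hij' : (i : ℕ) ≤ j := hij
      by_cases hi : m ≤ (i : ℕ)
      · have : m ≤ (j : ℕ) := hi.trans hij'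
        simp [hi, this]
      · simp [hi]
    have hb1 : Monotone ((fun i : Fin N => decide (m ≤ (i : ℕ))) ∘ σ) := by
      intro i j hij
      exact Prod.Lex.monotone_fst _ _ (hmono hij)
    rw [← Tuple.comp_sort_eq_comp_iff_monotone] at hb1
    have hb2 := hb
    rw [← Function.comp_id (fun i : Fin N => decide (m ≤ (i : ℕ))), ← Equiv.coe_refl,
      ← Tuple.comp_sort_eq_comp_iff_monotone, ← hb1] at hb2
    exact fun i => (congrFun hb2 i).symm
  have hσ : ∀ i, (σ i : ℕ) < m ↔ (i : ℕ) < m := fun i => by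
    rw [← not_le, ← not_le, not_iff_not]
    simpa using hbool i
  rw [sortKey_comp hσ] at hmono
  refine ⟨⟨m, hm, γ ∘ σ, fun i j hij hj => ?_, fun i j hi hij => ?_⟩, rfl, σ, hσ, fun i => rfl⟩
  · refine lt_of_le_of_ne ((sortKey_le_iff hij.le (Or.inl hj)).1 (hmono hij.le)) ?_
    have hi : (i : ℕ) < m := lt_trans hij hj
    rcases lt_trichotomy (σ i) (σ j) with h | h | h
    · exact (hγ _ _ h ((hσ j).2 hj)).symm
    · exact absurd (σ.injective h) hij.ne
    · exact hγ _ _ h ((hσ i).2 hi)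
  · exact (sortKey_le_iff hij.le (Or.inr hi)).1 (hmono hij.le)

/-! ### The step order refines strict dominance. -/

lemma DominanceLT.star_trans {Λ Ω Γ : SuperPartition N} (h : DominanceLT Λ.star Ω.star)
    (h' : DominanceLT Ω.star Γ.star) : DominanceLT Λ.star Γ.star := by
  refine ⟨h.1.trans h'.1, fun heq => ?_⟩
  have h1 := h.sum_sq_lt Λ.star_antitone
  have h2 := h'.sum_sq_lt Ω.star_antitone
  rw [heq] at h1
  exact lt_asymm h1 h2

/-- Positivity of `l` matters: `l = 0` is allowed for two equal parts after the semicolon. -/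
lemma Admissible.lt_dist {Λ : SuperPartition N} {i j : Fin N} {l : ℕ} (h : Λ.Admissible i j l)
    (hl : 0 < l) : l < Nat.dist (Λ.part i) (Λ.part j) := by
  rw [Nat.dist]
  obtain ⟨-, ⟨-, h⟩ | ⟨-, -, h⟩ | ⟨-, h⟩⟩ := h
  · omega
  · rcases abs_cases ((Λ.part i : ℤ) - Λ.part j) with ⟨h1, h2⟩ | ⟨h1, h2⟩ <;> omega
  · omega

lemma Step.eq_or_dominanceLT {Λ Ω : SuperPartition N} (h : Step Λ Ω) :
    Ω = Λ ∨ DominanceLT Ω.star Λ.star := by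
  obtain ⟨i, j, l, hadm, hre⟩ := h
  rcases Nat.eq_zero_or_pos l with rfl | hl
  · left
    apply ext_of_isRearrangement
    have : lower i j 0 Λ.part = Λ.part := by simp [lower]
    rwa [this] at hre
  · right
    obtain ⟨-, σ, -, hp⟩ := hre
    exact dominanceLT_of_lower hadm.1.ne hl (hadm.lt_dist hl) hp

lemma SLE.eq_or_dominanceLT {Λ Ω : SuperPartition N} (h : SLE Ω Λ) :
    Ω = Λ ∨ DominanceLT Ω.star Λ.star := by
  induction h with
  | refl => exact Or.inl rfl
  | tail _ hs ih =>
    rcases hs.eq_or_dominanceLT with rfl | h1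
    · exact ih
    · rcases ih with rfl | ih
      · exact Or.inr h1
      · exact Or.inr (h1.star_trans ih)

lemma SLT.dominanceLT {Λ Ω : SuperPartition N} (h : SLT Ω Λ) : DominanceLT Ω.star Λ.star :=
  h.1.eq_or_dominanceLT.resolve_left h.2

lemma SLT.trans {Λ Ω Γ : SuperPartition N} (h : SLT Γ Ω) (h' : SLT Ω Λ) : SLT Γ Λ := by
  refine ⟨Relation.ReflTransGen.trans h'.1 h.1, ?_⟩
  rintro rfl
  exact (h.dominanceLT.star_trans h'.dominanceLT).2 rfl

/-- A step that moves a positive number of units lowers the superpartition. -/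
lemma sLT_of_isRearrangement {Λ Ω : SuperPartition N} {i j : Fin N} {l : ℕ}
    (h : Λ.Admissible i j l) (hl : 0 < l) (hΩ : Ω.IsRearrangement Λ.m (lower i j l Λ.part)) :
    SLT Ω Λ := by
  refine ⟨Relation.ReflTransGen.single ⟨i, j, l, h, hΩ⟩, ?_⟩
  rintro rfl
  obtain ⟨-, σ, -, hp⟩ := hΩ
  exact (dominanceLT_of_lower h.1.ne hl (h.lt_dist hl) hp).2 rfl

/-! ### Eigenvalues. -/

/-- In `∑_{i<j} (f i - f j)`, an entry counts once positively for each later index and once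
negatively for each earlier one. The right side is symmetric in the entries, so the eigenvalue can
be computed from unsorted parts. -/
lemma two_mul_sum_weight_eq_sum_dist {f : Fin N → ℕ} (hf : Antitone f) :
    2 * ∑ j : Fin N, ((N : ℤ) + 1 - 2 * ((j : ℕ) + 1)) * f j
      = ∑ i, ∑ j, (Nat.dist (f i) (f j) : ℤ) := by
  have hd : ∀ i j, (Nat.dist (f i) (f j) : ℤ)
      = (if i < j then 1 else if j < i then -1 else 0) * ((f i : ℤ) - f j) := by
    intro i j
    rcases lt_trichotomy i j with h | rfl | h
    · have := hf h.le
      rw [Nat.dist_eq_sub_of_le_right this, if_pos h]; push_cast [this]; ring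
    · simp
    · have := hf h.le
      rw [Nat.dist_eq_sub_of_le this, if_neg h.le.not_gt, if_pos h]; push_cast [this]; ring
  have hs : ∀ i : Fin N, ∑ j : Fin N, (if i < j then (1 : ℤ) else if j < i then -1 else 0)
      = (N : ℤ) + 1 - 2 * ((i : ℕ) + 1) := by
    intro i
    have : ∀ j : Fin N, (if i < j then (1 : ℤ) else if j < i then -1 else 0)
        = (if i < j then 1 else 0) - (if j < i then 1 else 0) := by
      intro j
      rcases lt_trichotomy i j with h | rfl | h
      · simp [h, h.le.not_gt]
      · simp
      · simp [h, h.le.not_gt]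
    simp only [this, Finset.sum_sub_distrib, Finset.sum_boole]
    have h1 : (Finset.univ.filter fun j => i < j) = Finset.Ioi i := by ext; simp
    have h2 : (Finset.univ.filter fun j => j < i) = Finset.Iio i := by ext; simp
    rw [h1, h2, Fin.card_Ioi, Fin.card_Iio]
    have := i.2
    omega
  have hs' : ∀ j : Fin N, ∑ i : Fin N, (if i < j then (1 : ℤ) else if j < i then -1 else 0)
      = -((N : ℤ) + 1 - 2 * ((j : ℕ) + 1)) := by
    intro j
    rw [← hs j, ← Finset.sum_neg_distrib]
    refine Finset.sum_congr rfl fun i _ => ?_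
    rcases lt_trichotomy i j with h | rfl | h
    · simp [h, h.le.not_gt]
    · simp
    · simp [h, h.le.not_gt]
  simp only [hd, mul_sub, Finset.sum_sub_distrib]
  rw [Finset.sum_comm (f := fun i j => (if i < j then (1 : ℤ) else if j < i then -1 else 0) * f j)]
  simp only [← Finset.sum_mul, hs, hs']
  rw [two_mul, sub_eq_add_neg, ← Finset.sum_neg_distrib]
  simp only [neg_mul, neg_neg]

lemma eigenvalue_eq {K : Type*} [Field K] (β : K) (Λ : SuperPartition N) :
    Λ.eigenvalue β = ((∑ j, (Λ.star j : ℤ) ^ 2 : ℤ) : K)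
      + β * ((∑ j : Fin N, ((N : ℤ) + 1 - 2 * ((j : ℕ) + 1)) * Λ.star j : ℤ) : K) := by
  rw [eigenvalue, Finset.sum_add_distrib]
  push_cast
  rw [Finset.mul_sum]
  simp only [mul_assoc]

lemma two_mul_eigenvalue {K : Type*} [Field K] (β : K) (Λ : SuperPartition N) :
    2 * Λ.eigenvalue β = 2 * ∑ j, (Λ.part j : K) ^ 2
      + β * ∑ i, ∑ j, (Nat.dist (Λ.part i) (Λ.part j) : K) := by
  have h1 := two_mul_sum_weight_eq_sum_dist Λ.star_antitone
  have h2 : ∑ i, ∑ j, (Nat.dist (Λ.star i) (Λ.star j) : ℤ)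
      = ∑ i, ∑ j, (Nat.dist (Λ.part i) (Λ.part j) : ℤ) := by
    refine (Finset.sum_congr rfl fun i _ =>
      Λ.sum_star fun x => (Nat.dist (Λ.star i) x : ℤ)).trans ?_
    exact Λ.sum_star fun x => ∑ j, (Nat.dist x (Λ.part j) : ℤ)
  rw [eigenvalue_eq, mul_add, mul_left_comm]
  have h3 := congrArg (Int.cast : ℤ → K) (h1.trans h2)
  push_cast at h3 ⊢
  rw [h3, Λ.sum_star fun x => (x : K) ^ 2]

lemma eigenvalue_ne {K : Type*} [Field K] [CharZero K] {β : K}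
    (hβ : ∀ q : ℚ, q < 0 → β ≠ (q : K)) {Λ Ω : SuperPartition N}
    (h : DominanceLT Ω.star Λ.star) : Ω.eigenvalue β ≠ Λ.eigenvalue β := by
  intro heq
  rw [eigenvalue_eq, eigenvalue_eq] at heq
  have h1 : ∑ j, (Ω.star j : ℤ) ^ 2 < ∑ j, (Λ.star j : ℤ) ^ 2 := by
    exact_mod_cast h.sum_sq_lt Ω.star_antitone
  have h2 := h.1.sum_mul_le (fun j => (N : ℤ) + 1 - 2 * ((j : ℕ) + 1)) (fun a b hab => by
    have : (a : ℕ) ≤ b := hab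
    dsimp only
    omega)
  generalize ∑ j, (Ω.star j : ℤ) ^ 2 = A at *
  generalize ∑ j, (Λ.star j : ℤ) ^ 2 = B at *
  generalize ∑ j : Fin N, ((N : ℤ) + 1 - 2 * ((j : ℕ) + 1)) * Ω.star j = C at *
  generalize ∑ j : Fin N, ((N : ℤ) + 1 - 2 * ((j : ℕ) + 1)) * Λ.star j = D at *
  rcases h2.eq_or_lt with rfl | h2
  · have : (A : K) = B := by simpa using heq
    exact h1.ne (by exact_mod_cast this)
  -- Equal eigenvalues mean `A + βC = B + βD`; solving for `β` gives this negative rational.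
  · refine hβ ((A - B) / (D - C)) ?_ ?_
    · apply div_neg_of_neg_of_pos
      · rw [sub_neg]; exact_mod_cast h1
      · rw [sub_pos]; exact_mod_cast h2
    · have hne : (D : K) - C ≠ 0 := by
        rw [sub_ne_zero]; exact_mod_cast h2.ne'
      push_cast
      rw [eq_div_iff hne]
      linear_combination -heq

/-- Each part is at most the common size. Finiteness feeds the dimension count behind uniqueness. -/
lemma finite_dominanceLT (Λ : SuperPartition N) :
    {Ω : SuperPartition N | DominanceLT Ω.star Λ.star}.Finite := by
  set s := ∑ i, Λ.part i
  have : Set.InjOn (fun Ω : SuperPartition N => (Ω.m, Ω.part))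
      {Ω : SuperPartition N | DominanceLT Ω.star Λ.star} := fun a _ b _ hab => by
    rw [Prod.mk.injEq] at hab
    exact SuperPartition.ext hab.1 hab.2
  refine Set.Finite.of_finite_image (Set.Finite.subset
    ((Set.finite_Iic N).prod (Set.finite_Iic (fun _ : Fin N => s))) ?_) this
  rintro _ ⟨Ω, hΩ, rfl⟩
  refine ⟨Ω.m_le, fun i => ?_⟩
  have h1 := hΩ.1.1
  have h2 := Ω.sum_star id
  have h3 := Λ.sum_star id
  simp only [id] at h2 h3
  rw [h2, h3] at h1
  exact (Finset.single_le_sum (f := Ω.part) (fun _ _ => Nat.zero_le _) (Finset.mem_univ i)).trans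
    h1.le

end SuperPartition

/-! ### Permutation operators and clearing of denominators. -/

noncomputable section

namespace SuperPoly

variable {K : Type*} [Field K] {N : ℕ}

/-- The action of a permutation on the anticommuting variables. -/
def fermPerm (σ : Equiv.Perm (Fin N)) : Ferm K N →ₐ[K] Ferm K N :=
  ExteriorAlgebra.map (LinearMap.funLeft K K σ.symm)

lemma fermPerm_ι (σ : Equiv.Perm (Fin N)) (v : Fin N → K) :
    fermPerm σ (ExteriorAlgebra.ι K v) = ExteriorAlgebra.ι K (fun k => v (σ.symm k)) := by
  rw [fermPerm, ExteriorAlgebra.map_apply_ι]; rfl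

lemma fermPerm_θ (σ : Equiv.Perm (Fin N)) (i : Fin N) :
    fermPerm σ (θ i : Ferm K N) = θ (σ i) := by
  rw [θ, fermPerm_ι, θ]
  congr 1
  ext k
  simp only [Pi.single_apply, Equiv.symm_apply_eq]

lemma fermPerm_mul (σ τ : Equiv.Perm (Fin N)) (w : Ferm K N) :
    fermPerm σ (fermPerm τ w) = fermPerm (σ * τ) w := by
  have h : (fermPerm σ).comp (fermPerm τ) = (fermPerm (σ * τ) : Ferm K N →ₐ[K] Ferm K N) := by
    apply ExteriorAlgebra.hom_ext
    ext v : 2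
    simp only [LinearMap.comp_apply, AlgHom.toLinearMap_apply, AlgHom.comp_apply, fermPerm_ι]
    rfl
  exact DFunLike.congr_fun h w

lemma kappa_apply (i j : Fin N) (w : Ferm K N) :
    kappa i j w = w - (θ i - θ j) * (dθ i w - dθ j w) := by
  simp [kappa]

lemma theta_sub_eq (i j : Fin N) :
    (θ i - θ j : Ferm K N) = ExteriorAlgebra.ι K (Pi.single i 1 - Pi.single j 1) := by
  simp [θ]

/-- Swapping two coordinates of `v` subtracts `(v i - v j)(e_i - e_j)`; the rest follows from the
Leibniz rule for `∂_θ`, since `θ_i - θ_j` squares to zero and anticommutes with vectors. -/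
lemma kappa_ι_mul {i j : Fin N} (v : Fin N → K) (w : Ferm K N) :
    kappa i j (ExteriorAlgebra.ι K v * w)
      = ExteriorAlgebra.ι K (fun k => v (Equiv.swap i j k)) * kappa i j w := by
  have hv : ExteriorAlgebra.ι K (fun k => v (Equiv.swap i j k))
      = ExteriorAlgebra.ι K v - (v i - v j) • (θ i - θ j : Ferm K N) := by
    rw [theta_sub_eq, ← map_smul, ← map_sub]
    congr 1
    ext k
    by_cases hi : k = i
    · subst hi
      by_cases hj : k = j
      · subst hj; simp
      · simp [hj]
    · by_cases hj : k = j
      · subst hj; simp [hi]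
      · simp [hi, hj, Equiv.swap_apply_of_ne_of_ne]
  have hd : ∀ i : Fin N, dθ i (ExteriorAlgebra.ι K v * w)
      = v i • w - ExteriorAlgebra.ι K v * dθ i w := fun i =>
    CliffordAlgebra.contractLeft_ι_mul (Q := (0 : QuadraticForm K (Fin N → K))) (d := LinearMap.proj i) v w
  rw [kappa_apply, kappa_apply, hv, hd, hd]
  have hsq : (θ i - θ j : Ferm K N) * (θ i - θ j) = 0 := by
    rw [theta_sub_eq]; exact ExteriorAlgebra.ι_sq_zero _
  have hanti : (θ i - θ j : Ferm K N) * ExteriorAlgebra.ι K v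
      = - (ExteriorAlgebra.ι K v * (θ i - θ j)) := by
    rw [theta_sub_eq, eq_neg_iff_add_eq_zero]; exact ExteriorAlgebra.ι_add_mul_swap _ _
  generalize (θ i - θ j : Ferm K N) = δ at *
  generalize (ExteriorAlgebra.ι K v : Ferm K N) = u at *
  have e1 : v i • w - u * dθ i w - (v j • w - u * dθ j w)
      = (v i - v j) • w - u * (dθ i w - dθ j w) := by
    rw [sub_smul, mul_sub]; abel
  rw [e1]
  generalize (dθ i w - dθ j w) = D
  rw [mul_sub, mul_smul_comm, ← mul_assoc, hanti, sub_mul, mul_sub, mul_sub, smul_mul_assoc,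
    smul_mul_assoc, ← mul_assoc, ← mul_assoc, hsq]
  simp only [neg_mul, zero_mul, smul_zero]
  abel

/-- Turns the differential operator `κ_ij` into the algebra automorphism exchanging `θ_i` and `θ_j`.
-/
lemma kappa_eq_fermPerm (i j : Fin N) (w : Ferm K N) :
    kappa i j w = fermPerm (Equiv.swap i j) w := by
  induction w using CliffordAlgebra.left_induction with
  | algebraMap r =>
    have hd : ∀ i : Fin N, dθ i (algebraMap K (Ferm K N) r) = 0 := fun i =>
      CliffordAlgebra.contractLeft_algebraMap (Q := (0 : QuadraticForm K (Fin N → K))) _ r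
    have h1 := kappa_apply i j (algebraMap K (Ferm K N) r)
    rw [hd, hd, sub_zero, mul_zero, sub_zero] at h1
    exact h1.trans ((fermPerm (Equiv.swap i j)).commutes r).symm
  | add x y hx hy => rw [map_add, map_add, hx, hy]
  | ι_mul x m hx =>
    have h1 := kappa_ι_mul (i := i) (j := j) m x
    refine h1.trans ?_
    rw [hx]
    refine Eq.trans ?_ (map_mul (fermPerm (Equiv.swap i j)) (ExteriorAlgebra.ι K m) x).symm
    rw [fermPerm_ι, Equiv.symm_swap]

lemma exchange_tmul (σ : Equiv.Perm (Fin N)) (p : Bos K N) (w : Ferm K N) :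
    exchange σ (p ⊗ₜ[K] w) = MvPolynomial.rename σ p ⊗ₜ[K] fermPerm σ w := rfl

lemma exchange_mul (σ τ : Equiv.Perm (Fin N)) (x : SPoly K N) :
    exchange σ (exchange τ x) = exchange (σ * τ) x := by
  induction x using TensorProduct.induction_on with
  | zero => simp
  | add x y hx hy => simp only [map_add, hx, hy]
  | tmul p w =>
    rw [exchange_tmul, exchange_tmul, exchange_tmul, fermPerm_mul, MvPolynomial.rename_rename]
    rfl

lemma exchange_smul_bos (σ : Equiv.Perm (Fin N)) (p : Bos K N) (x : SPoly K N) :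
    exchange σ (p • x) = MvPolynomial.rename σ p • exchange σ x := by
  induction x using TensorProduct.induction_on with
  | zero => simp
  | add x y hx hy => simp only [map_add, smul_add, hx, hy]
  | tmul q w =>
    simp only [TensorProduct.smul_tmul', exchange_tmul, smul_eq_mul, map_mul]

/-- The sum over all simultaneous permutations of the variables. -/
def symmetrize : SPoly K N →ₗ[K] SPoly K N := ∑ σ : Equiv.Perm (Fin N), exchange σ

lemma symmetrize_apply (x : SPoly K N) :
    symmetrize x = ∑ σ : Equiv.Perm (Fin N), exchange σ x := by
  simp [symmetrize]

lemma symmetrize_exchange (τ : Equiv.Perm (Fin N)) (x : SPoly K N) :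
    symmetrize (exchange τ x) = symmetrize x := by
  simp only [symmetrize_apply, exchange_mul]
  exact Fintype.sum_equiv (Equiv.mulRight τ) _ _ fun σ => rfl

lemma exchange_symmetrize (τ : Equiv.Perm (Fin N)) (x : SPoly K N) :
    exchange τ (symmetrize x) = symmetrize x := by
  simp only [symmetrize_apply, map_sum, exchange_mul]
  exact Fintype.sum_equiv (Equiv.mulLeft τ) _ _ fun σ => rfl

/-- The pair interaction, multiplied by `(z_i - z_j)^2`. -/
def pairNumerator (i j : Fin N) : SPoly K N →ₗ[K] SPoly K N :=
  TensorProduct.map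
    (LinearMap.mulLeft K (MvPolynomial.X i ^ 2 - MvPolynomial.X j ^ 2) ∘ₗ (euler i - euler j))
    LinearMap.id
  - (2 : K) • TensorProduct.map
    (LinearMap.mulLeft K (MvPolynomial.X i * MvPolynomial.X j)) (LinearMap.id - kappa i j)

lemma pairNumerator_tmul (i j : Fin N) (p : Bos K N) (w : Ferm K N) :
    pairNumerator i j (p ⊗ₜ[K] w)
      = ((MvPolynomial.X i ^ 2 - MvPolynomial.X j ^ 2) * (euler i p - euler j p)) ⊗ₜ[K] w
        - (2 : K) • ((MvPolynomial.X i * MvPolynomial.X j * p) ⊗ₜ[K]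
            (w - fermPerm (Equiv.swap i j) w)) := by
  simp [pairNumerator, kappa_eq_fermPerm, mul_assoc]

lemma rename_euler (σ : Equiv.Perm (Fin N)) (i : Fin N) (p : Bos K N) :
    MvPolynomial.rename σ (euler i p) = euler (σ i) (MvPolynomial.rename σ p) := by
  simp [euler, MvPolynomial.pderiv_rename σ.injective]

lemma exchange_pairNumerator (σ : Equiv.Perm (Fin N)) (i j : Fin N) (x : SPoly K N) :
    exchange σ (pairNumerator i j x) = pairNumerator (σ i) (σ j) (exchange σ x) := by
  induction x using TensorProduct.induction_on with
  | zero => simp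
  | add x y hx hy => simp only [map_add, hx, hy]
  | tmul p w =>
    rw [exchange_tmul, pairNumerator_tmul, pairNumerator_tmul]
    simp only [map_sub, map_smul, exchange_tmul, map_mul, map_pow, MvPolynomial.rename_X,
      rename_euler, fermPerm_mul]
    rw [Equiv.mul_swap_eq_swap_mul]

lemma incl_tmul (p : Bos K N) (w : Ferm K N) :
    incl (p ⊗ₜ[K] w) = (toFrac p : BosFrac K N) ⊗ₜ[K] w := rfl

lemma toFrac_apply (p : Bos K N) : toFrac p = algebraMap (Bos K N) (BosFrac K N) p := rfl

lemma incl_smul_bos (p : Bos K N) (x : SPoly K N) :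
    incl (p • x) = algebraMap (Bos K N) (BosFrac K N) p • incl x := by
  induction x using TensorProduct.induction_on with
  | zero => simp
  | add x y hx hy => simp only [map_add, smul_add, hx, hy]
  | tmul q w =>
    simp only [TensorProduct.smul_tmul', incl_tmul, smul_eq_mul, toFrac_apply, map_mul]

lemma incl_injective : Function.Injective (incl : SPoly K N → SRat K N) := by
  have h : Function.Injective (toFrac : Bos K N →ₗ[K] BosFrac K N) :=
    IsFractionRing.injective (Bos K N) (BosFrac K N)
  exact Module.Flat.rTensor_preserves_injective_linearMap (M := Ferm K N) _ h

lemma algebraMap_X_sub_ne_zero {i j : Fin N} (h : i ≠ j) :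
    algebraMap (Bos K N) (BosFrac K N) (MvPolynomial.X i - MvPolynomial.X j) ≠ 0 := by
  rw [Ne, FaithfulSMul.algebraMap_eq_zero_iff, sub_eq_zero]
  exact fun e => h (MvPolynomial.X_injective e)

/-- Transfers the computation from rational functions to polynomials. -/
lemma smul_pair_eq_incl {i j : Fin N} (h : i ≠ j) (x : SPoly K N) :
    algebraMap (Bos K N) (BosFrac K N) ((MvPolynomial.X i - MvPolynomial.X j) ^ 2) •
      (termB i j x - (2 : K) • termF i j x) = incl (pairNumerator i j x) := by
  have h0 := algebraMap_X_sub_ne_zero (K := K) h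
  induction x using TensorProduct.induction_on with
  | zero => simp
  | add x y hx hy =>
    simp only [map_add]
    rw [← hx, ← hy, ← smul_add]
    congr 1
    rw [smul_add]
    abel
  | tmul p w =>
    rw [pairNumerator_tmul, map_sub, map_smul, incl_tmul, incl_tmul, smul_sub, smul_comm _ (2 : K)]
    simp only [termB, termF, TensorProduct.map_tmul, TensorProduct.smul_tmul', LinearMap.id_apply,
      LinearMap.comp_apply, LinearMap.mulLeft_apply, LinearMap.sub_apply, kappa_eq_fermPerm,
      smul_eq_mul, toFrac_apply, z]
    rw [map_sub] at h0
    congr 2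
    · simp only [map_sub, map_mul, map_pow]
      field_simp
      ring
    · simp only [map_sub, map_mul, map_pow]
      field_simp

end SuperPoly

end

/-! ### The pair interaction on a monomial. -/

noncomputable section

namespace SuperPoly

variable {K : Type*} [Field K] {N : ℕ}

/-- The monomial `z^γ`. -/
def bosMonomial (K : Type*) [Field K] {N : ℕ} (γ : Fin N → ℕ) : Bos K N :=
  ∏ i, MvPolynomial.X i ^ γ i

lemma rename_bosMonomial (σ : Equiv.Perm (Fin N)) (γ : Fin N → ℕ) :
    MvPolynomial.rename σ (bosMonomial K γ) = bosMonomial K (γ ∘ σ.symm) := by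
  simp only [bosMonomial, map_prod, map_pow, MvPolynomial.rename_X]
  exact Fintype.prod_equiv σ _ _ fun i => by simp

lemma euler_bosMonomial (i : Fin N) (γ : Fin N → ℕ) :
    euler i (bosMonomial K γ) = (γ i : K) • bosMonomial K γ := by
  have h : bosMonomial K γ = MvPolynomial.monomial (Finsupp.equivFunOnFinite.symm γ) 1 := by
    rw [MvPolynomial.monomial_eq, Finsupp.prod_fintype _ _ (by simp)]
    simp [bosMonomial]
  have h2 := MvPolynomial.X_mul_pderiv_monomial (R := K) (i := i)
    (m := Finsupp.equivFunOnFinite.symm γ) (r := 1)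
  rw [← h] at h2
  simpa [euler, Nat.cast_smul_eq_nsmul] using h2

lemma bosMonomial_eq_mul {i j : Fin N} (h : i ≠ j) (γ : Fin N → ℕ) :
    bosMonomial K γ = MvPolynomial.X i ^ γ i * MvPolynomial.X j ^ γ j *
      ∏ k ∈ (Finset.univ.erase i).erase j, MvPolynomial.X k ^ γ k := by
  rw [bosMonomial, ← Finset.mul_prod_erase _ _ (Finset.mem_univ i),
    ← Finset.mul_prod_erase (Finset.univ.erase i) _ (Finset.mem_erase.2 ⟨h.symm, Finset.mem_univ j⟩),
    mul_assoc]

/-- Subtracting `n x^n (x - y)^2` from both sides turns the right side into `n x^n (x² - y²) -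
2xy(x^n - y^n)`, the two-variable pair numerator; this explains the correction term in `spread`. -/
lemma two_mul_sum_mul_pow (R : Type*) [CommRing R] (x y : R) (n : ℕ) :
    (x - y) ^ 2 * ∑ l ∈ Finset.range n, (2 * ((n : R) - l)) * (x ^ (n - l) * y ^ l)
      = 2 * n * x ^ (n + 1) * (x - y) - 2 * (x * y) * (x ^ n - y ^ n) := by
  induction n with
  | zero => simp
  | succ n ih =>
    rw [Finset.sum_range_succ']
    have : ∑ l ∈ Finset.range n, (2 * (((n + 1 : ℕ) : R) - ((l + 1 : ℕ) : R)))
          * (x ^ (n + 1 - (l + 1)) * y ^ (l + 1))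
        = y * ∑ l ∈ Finset.range n, (2 * ((n : R) - l)) * (x ^ (n - l) * y ^ l) := by
      rw [Finset.mul_sum]
      refine Finset.sum_congr rfl fun l _ => ?_
      rw [Nat.add_sub_add_right]
      push_cast
      ring
    rw [this, mul_add, mul_left_comm, ih]
    push_cast
    ring

lemma lower_comm {i j : Fin N} (h : i ≠ j) (l : ℕ) (γ : Fin N → ℕ) :
    SuperPartition.lower i j l γ = SuperPartition.lower j i l γ := by
  unfold SuperPartition.lower
  rcases lt_trichotomy (γ i) (γ j) with h1 | h1 | h1
  · rw [if_neg h1.le.not_gt, if_pos h1, if_pos h1, Function.update_comm h]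
  · simp [h1]
  · rw [if_pos h1, if_neg h1.le.not_gt, if_pos h1, Function.update_comm h]

lemma lower_of_lt {i j : Fin N} {γ : Fin N → ℕ} (h : γ j < γ i) (l : ℕ) :
    SuperPartition.lower i j l γ
      = Function.update (Function.update γ i (γ i - l)) j (γ j + l) := if_pos h

lemma lower_zero (i j : Fin N) (γ : Fin N → ℕ) : SuperPartition.lower i j 0 γ = γ := by
  simp [SuperPartition.lower]

/-- The polynomial produced by the pair interaction of the variables `i` and `j` on `z^γ`. -/
def spread (K : Type*) [Field K] {N : ℕ} (i j : Fin N) (γ : Fin N → ℕ) : Bos K N :=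
  ∑ l ∈ Finset.range (Nat.dist (γ i) (γ j)),
    (2 * ((Nat.dist (γ i) (γ j) : K) - l)) • bosMonomial K (SuperPartition.lower i j l γ)
  - (Nat.dist (γ i) (γ j) : K) • bosMonomial K γ

lemma spread_comm (i j : Fin N) (γ : Fin N → ℕ) : spread K i j γ = spread K j i γ := by
  rcases eq_or_ne i j with rfl | h
  · rfl
  · simp only [spread, Nat.dist_comm (γ i), lower_comm h]

lemma spread_self (i : Fin N) (γ : Fin N → ℕ) : spread K i i γ = 0 := by
  simp [spread]

/-- After factoring out `(z_i z_j)^{γ_j}` and the other variables, this is `two_mul_sum_mul_pow`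
with `n = γ_i - γ_j`. -/
lemma spread_spec_of_le {i j : Fin N} (h : i ≠ j) {γ : Fin N → ℕ} (hle : γ j ≤ γ i) :
    (MvPolynomial.X i ^ 2 - MvPolynomial.X j ^ 2) *
        (((γ i : K) - γ j) • bosMonomial K γ)
      - (2 : K) • (MvPolynomial.X i * MvPolynomial.X j *
          (bosMonomial K γ - bosMonomial K (γ ∘ Equiv.swap i j)))
      = (MvPolynomial.X i - MvPolynomial.X j) ^ 2 * spread K i j γ := by
  obtain ⟨n, hn⟩ := Nat.exists_eq_add_of_le hle
  have hd : Nat.dist (γ i) (γ j) = n := by rw [Nat.dist_eq_sub_of_le_right hle]; omega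
  set R : Bos K N := ∏ k ∈ (Finset.univ.erase i).erase j, MvPolynomial.X k ^ γ k with hR
  have e1 : bosMonomial K γ = (MvPolynomial.X i * MvPolynomial.X j) ^ γ j * R *
      MvPolynomial.X i ^ n := by
    rw [bosMonomial_eq_mul h, hn, ← hR]; ring
  have e2 : bosMonomial K (γ ∘ Equiv.swap i j) =
      (MvPolynomial.X i * MvPolynomial.X j) ^ γ j * R * MvPolynomial.X j ^ n := by
    rw [bosMonomial_eq_mul h]
    have : ∏ k ∈ (Finset.univ.erase i).erase j,
        (MvPolynomial.X k : Bos K N) ^ (γ ∘ Equiv.swap i j) k = R := by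
      refine Finset.prod_congr rfl fun k hk => ?_
      simp only [Finset.mem_erase] at hk
      rw [Function.comp_apply, Equiv.swap_apply_of_ne_of_ne hk.2.1 hk.1]
    rw [this]
    simp only [Function.comp_apply, Equiv.swap_apply_left, Equiv.swap_apply_right, hn]
    ring
  have e3 : ∀ l ∈ Finset.range n, (2 * ((n : K) - l)) •
      bosMonomial K (SuperPartition.lower i j l γ)
      = (MvPolynomial.X i * MvPolynomial.X j) ^ γ j * R * ((2 * ((n : Bos K N) - (l : Bos K N))) *
        (MvPolynomial.X i ^ (n - l) * MvPolynomial.X j ^ l)) := by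
    intro l hl
    have hl := Finset.mem_range.1 hl
    rw [lower_of_lt (by omega : γ j < γ i), bosMonomial_eq_mul h]
    have : ∏ k ∈ (Finset.univ.erase i).erase j, (MvPolynomial.X k : Bos K N) ^
        (Function.update (Function.update γ i (γ i - l)) j (γ j + l)) k = R := by
      refine Finset.prod_congr rfl fun k hk => ?_
      simp only [Finset.mem_erase] at hk
      rw [Function.update_of_ne hk.1, Function.update_of_ne hk.2.1]
    rw [this]
    have e4 : γ i - l = γ j + (n - l) := by omega
    simp only [Function.update_self, Function.update_of_ne h, e4]
    rw [MvPolynomial.smul_eq_C_mul]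
    simp only [map_mul, map_sub, map_natCast, map_ofNat]
    ring
  have key := two_mul_sum_mul_pow (Bos K N) (MvPolynomial.X i) (MvPolynomial.X j) n
  rw [spread, hd, Finset.sum_congr rfl e3, ← Finset.mul_sum, e1, e2, hn]
  simp only [MvPolynomial.smul_eq_C_mul, map_sub, map_natCast, map_ofNat]
  push_cast
  linear_combination -((MvPolynomial.X i * MvPolynomial.X j) ^ γ j * R) * key

lemma spread_spec {i j : Fin N} (h : i ≠ j) (γ : Fin N → ℕ) :
    (MvPolynomial.X i ^ 2 - MvPolynomial.X j ^ 2) *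
        (((γ i : K) - γ j) • bosMonomial K γ)
      - (2 : K) • (MvPolynomial.X i * MvPolynomial.X j *
          (bosMonomial K γ - bosMonomial K (γ ∘ Equiv.swap i j)))
      = (MvPolynomial.X i - MvPolynomial.X j) ^ 2 * spread K i j γ := by
  rcases le_total (γ j) (γ i) with hle | hle
  · exact spread_spec_of_le h hle
  · have := spread_spec_of_le (K := K) h.symm hle
    rw [Equiv.swap_comm, spread_comm] at this
    rw [sub_sq_comm, ← this, mul_comm (MvPolynomial.X i), ← neg_sub (MvPolynomial.X j ^ 2),
      ← neg_sub (γ j : K), neg_smul, neg_mul_neg]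

/-- Adding the exchanged term is what creates divisibility: `κ_ij` carries the fermionic factor of
each summand to that of the other, so the coefficient of `w` involves `z^γ` minus its swap, as in
`spread_spec`, and the coefficient of `κ_ij w` is its swapped image. -/
lemma pairNumerator_add_exchange {i j : Fin N} (h : i ≠ j) (γ : Fin N → ℕ) (w : Ferm K N) :
    pairNumerator i j (bosMonomial K γ ⊗ₜ[K] w
        + exchange (Equiv.swap i j) (bosMonomial K γ ⊗ₜ[K] w))
      = (MvPolynomial.X i - MvPolynomial.X j : Bos K N) ^ 2 • (spread K i j γ ⊗ₜ[K] w
        + exchange (Equiv.swap i j) (spread K i j γ ⊗ₜ[K] w)) := by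
  have hs := spread_spec (K := K) h γ
  have hw : fermPerm (Equiv.swap i j) (fermPerm (Equiv.swap i j) w) = w := by
    rw [fermPerm_mul, Equiv.swap_mul_self]
    have : (fermPerm (1 : Equiv.Perm (Fin N)) : Ferm K N →ₐ[K] Ferm K N) = AlgHom.id K _ := by
      apply ExteriorAlgebra.hom_ext
      ext v : 2
      simp only [LinearMap.comp_apply, AlgHom.toLinearMap_apply, fermPerm_ι]
      rfl
    rw [this]; rfl
  have hs' := congrArg (MvPolynomial.rename (Equiv.swap i j)) hs
  have hγ : (γ ∘ Equiv.swap i j) ∘ Equiv.swap i j = γ := by ext; simp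
  simp only [map_sub, map_mul, map_pow, map_smul, MvPolynomial.rename_X, Equiv.swap_apply_left,
    Equiv.swap_apply_right, rename_bosMonomial, Equiv.symm_swap, hγ] at hs'
  rw [smul_add, exchange_tmul, exchange_tmul, TensorProduct.smul_tmul', TensorProduct.smul_tmul',
    smul_eq_mul, smul_eq_mul, ← hs, sub_sq_comm (MvPolynomial.X i), ← hs', map_add,
    pairNumerator_tmul, pairNumerator_tmul, hw, rename_bosMonomial, Equiv.symm_swap]
  simp only [euler_bosMonomial, Function.comp_apply, Equiv.swap_apply_left,
    Equiv.swap_apply_right, TensorProduct.tmul_sub, TensorProduct.sub_tmul, mul_sub, smul_sub,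
    TensorProduct.smul_tmul', sub_smul, sub_mul]
  rw [mul_comm (MvPolynomial.X j : Bos K N) (MvPolynomial.X i)]
  abel

end SuperPoly

end

/-! ### Symmetrized lowered monomials lie below `Λ`. -/

noncomputable section

namespace SuperPoly

variable {K : Type*} [Field K] {N : ℕ}

open SuperPartition

/-- The product `θ_1 ⋯ θ_m`. -/
def thetaProd (K : Type*) [Field K] {N m : ℕ} (hm : m ≤ N) : Ferm K N :=
  (List.ofFn fun k : Fin m => (θ (Fin.castLE hm k) : Ferm K N)).prod

lemma leadingTerm_eq (Λ : SuperPartition N) :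
    leadingTerm K Λ = bosMonomial K Λ.part ⊗ₜ[K] thetaProd K Λ.m_le := rfl

lemma fermPerm_thetaProd {m : ℕ} (hm : m ≤ N) (σ : Equiv.Perm (Fin N)) (τ : Equiv.Perm (Fin m))
    (h : ∀ k, σ (Fin.castLE hm k) = Fin.castLE hm (τ k)) :
    fermPerm σ (thetaProd K hm) = Equiv.Perm.sign τ • thetaProd K hm := by
  have h1 := (ExteriorAlgebra.ιMulti K m).map_perm
    (fun k : Fin m => (Pi.single (Fin.castLE hm k) 1 : Fin N → K)) τ
  rw [ExteriorAlgebra.ιMulti_apply, ExteriorAlgebra.ιMulti_apply] at h1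
  refine Eq.trans ?_ h1
  rw [thetaProd, map_list_prod, List.map_ofFn]
  congr 2
  ext k
  rw [Function.comp_apply, fermPerm_θ, h]
  rfl

lemma exists_perm_castLE {m : ℕ} (hm : m ≤ N) (σ : Equiv.Perm (Fin N))
    (h : ∀ i, (σ i : ℕ) < m ↔ (i : ℕ) < m) :
    ∃ τ : Equiv.Perm (Fin m), ∀ k, σ (Fin.castLE hm k) = Fin.castLE hm (τ k) := by
  let f : Fin m → Fin m := fun k => ⟨σ (Fin.castLE hm k), (h _).2 k.2⟩
  have hf : Function.Injective f := fun a b hab => by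
    have : σ (Fin.castLE hm a) = σ (Fin.castLE hm b) := Fin.ext (Fin.mk.inj_iff.1 hab)
    exact Fin.castLE_injective hm (σ.injective this)
  exact ⟨Equiv.ofBijective f (Finite.injective_iff_bijective.1 hf), fun k => rfl⟩

lemma exists_unit_fermPerm_thetaProd {m : ℕ} (hm : m ≤ N) (σ : Equiv.Perm (Fin N))
    (h : ∀ i, (σ i : ℕ) < m ↔ (i : ℕ) < m) :
    ∃ s : ℤˣ, fermPerm σ (thetaProd K hm) = s • thetaProd K hm := by
  obtain ⟨τ, hτ⟩ := exists_perm_castLE hm σ h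
  exact ⟨_, fermPerm_thetaProd hm σ τ hτ⟩

lemma fermPerm_swap_thetaProd {m : ℕ} (hm : m ≤ N) {i j : Fin N} (hij : i ≠ j)
    (hi : (i : ℕ) < m) (hj : (j : ℕ) < m) :
    fermPerm (Equiv.swap i j) (thetaProd K hm) = - thetaProd K hm := by
  have hne : (⟨i, hi⟩ : Fin m) ≠ ⟨j, hj⟩ := fun h => hij (Fin.ext (Fin.mk.inj_iff.1 h))
  have := fermPerm_thetaProd (K := K) hm (Equiv.swap i j) (Equiv.swap ⟨i, hi⟩ ⟨j, hj⟩) (fun k => by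
    have := (Fin.castLE_injective hm).map_swap ⟨i, hi⟩ ⟨j, hj⟩ k
    exact this.symm)
  rw [this, Equiv.Perm.sign_swap hne]
  simp

lemma tmul_unit_smul_mem {S : Submodule K (SPoly K N)} (s : ℤˣ) {p : Bos K N} {w : Ferm K N}
    (h : symmetrize (p ⊗ₜ[K] w) ∈ S) : symmetrize (p ⊗ₜ[K] (s • w)) ∈ S := by
  rcases Int.units_eq_one_or s with rfl | rfl
  · simpa using h
  · have : ((-1 : ℤˣ) • w) = -w := by simp
    rw [this, TensorProduct.tmul_neg, map_neg]
    exact S.neg_mem h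

/-- Permuting exponents within the two blocks changes the symmetrization only by the sign from `θ_1
⋯ θ_m`, invisible to a submodule. -/
lemma symmetrize_rename_mem {S : Submodule K (SPoly K N)} {m : ℕ} (hm : m ≤ N)
    {σ : Equiv.Perm (Fin N)} (hσ : ∀ i, (σ i : ℕ) < m ↔ (i : ℕ) < m) {γ : Fin N → ℕ}
    (h : symmetrize (bosMonomial K (γ ∘ σ) ⊗ₜ[K] thetaProd K hm) ∈ S) :
    symmetrize (bosMonomial K γ ⊗ₜ[K] thetaProd K hm) ∈ S := by
  obtain ⟨s, hs⟩ := exists_unit_fermPerm_thetaProd (K := K) hm σ.symm (fun i => by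
    have := hσ (σ.symm i)
    rw [Equiv.apply_symm_apply] at this
    exact this.symm)
  rw [← symmetrize_exchange σ.symm, exchange_tmul, rename_bosMonomial, hs, Equiv.symm_symm]
  exact tmul_unit_smul_mem s h

lemma monomial_eq (Λ : SuperPartition N) :
    monomial K Λ = (Λ.normalization : K)⁻¹ • symmetrize (leadingTerm K Λ) := by
  rw [monomial, symmetrize_apply]

variable [CharZero K]

lemma symmetrize_leadingTerm (Λ : SuperPartition N) :
    symmetrize (leadingTerm K Λ) = (Λ.normalization : K) • monomial K Λ := by
  have : (Λ.normalization : K) ≠ 0 := by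
    rw [Nat.cast_ne_zero]
    exact Finset.prod_ne_zero_iff.2 fun a _ => Nat.factorial_ne_zero _
  rw [monomial, smul_inv_smul₀ this, symmetrize_apply]

/-- If two of the first `m` exponents agree, exchanging those variables negates the term, so its
symmetrization vanishes. Otherwise it is a multiple of some `m_Ω`. -/
lemma symmetrize_tmul_thetaProd_mem {S : Submodule K (SPoly K N)} {m : ℕ} (hm : m ≤ N)
    (γ : Fin N → ℕ)
    (h : ∀ Ω : SuperPartition N, Ω.IsRearrangement m γ → monomial K Ω ∈ S) :
    symmetrize (bosMonomial K γ ⊗ₜ[K] thetaProd K hm) ∈ S := by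
  by_cases hγ : ∀ i j : Fin N, i < j → (j : ℕ) < m → γ i ≠ γ j
  · obtain ⟨Ω, hΩ⟩ := exists_isRearrangement hm γ hγ
    have hmem := h Ω hΩ
    obtain ⟨rfl, σ, hσ, hp⟩ := hΩ
    have hp' : Ω.part = γ ∘ σ := funext hp
    apply symmetrize_rename_mem hm hσ
    rw [← hp', ← leadingTerm_eq, symmetrize_leadingTerm]
    exact S.smul_mem _ hmem
  · push Not at hγ
    obtain ⟨i, j, hij, hj, heq⟩ := hγ
    have h1 := symmetrize_exchange (Equiv.swap i j) (bosMonomial K γ ⊗ₜ[K] thetaProd K hm)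
    have hi : (i : ℕ) < m := lt_trans hij hj
    have h2 : γ ∘ Equiv.swap i j = γ := by
      ext k
      rw [Function.comp_apply, Equiv.swap_apply_def]
      split_ifs with h h
      · rw [h, heq]
      · rw [h, heq]
      · rfl
    rw [exchange_tmul, rename_bosMonomial, Equiv.symm_swap, h2,
      fermPerm_swap_thetaProd hm hij.ne hi hj, TensorProduct.tmul_neg, map_neg] at h1
    have h3 := eq_neg_iff_add_eq_zero.1 h1.symm
    rw [← two_smul K] at h3
    rw [(smul_eq_zero.1 h3).resolve_left two_ne_zero]
    exact S.zero_mem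

lemma lower_dist_sub_comp_swap {i j : Fin N} (h : i ≠ j) {γ : Fin N → ℕ} (hlt : γ j < γ i) {l : ℕ}
    (hl : l < Nat.dist (γ i) (γ j)) :
    lower i j (Nat.dist (γ i) (γ j) - l) γ = lower i j l γ ∘ Equiv.swap i j := by
  rw [lower_of_lt hlt, lower_of_lt hlt]
  rw [Nat.dist_eq_sub_of_le_right hlt.le] at hl ⊢
  ext k
  by_cases hi : k = i
  · subst hi
    simp only [Function.comp_apply, Equiv.swap_apply_left, Function.update_self,
      Function.update_of_ne h]
    omega
  · by_cases hj : k = j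
    · subst hj
      simp only [Function.comp_apply, Equiv.swap_apply_right, Function.update_self,
        Function.update_of_ne h]
      omega
    · rw [Function.comp_apply, Equiv.swap_apply_of_ne_of_ne hi hj]
      simp [Function.update_of_ne, hi, hj]

/-- The span of the monomial superpolynomials below `Λ`. -/
def lowerSpan (K : Type*) [Field K] {N : ℕ} (Λ : SuperPartition N) : Submodule K (SPoly K N) :=
  Submodule.span K {g | ∃ Ω : SuperPartition N, Ω.SLT Λ ∧ g = monomial K Ω}

lemma symmetrize_lower_mem_of_admissible {Λ : SuperPartition N} {i j : Fin N} {l : ℕ}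
    (hadm : Λ.Admissible i j l) (hl : 0 < l) :
    symmetrize (bosMonomial K (lower i j l Λ.part) ⊗ₜ[K] thetaProd K Λ.m_le) ∈ lowerSpan K Λ :=
  symmetrize_tmul_thetaProd_mem _ _ fun Ω hΩ =>
    Submodule.subset_span ⟨Ω, sLT_of_isRearrangement hadm hl hΩ, rfl⟩

/-- Within a block, moving `l` or `d - l` units (`d` the difference of the parts) gives swapped
results, so the half range of allowed steps suffices. For a mixed pair the swap breaks the blocks,
but there every `0 < l < d` is allowed. -/
lemma symmetrize_lower_mem_of_lt {Λ : SuperPartition N} {i j : Fin N} (hij : i < j) {l : ℕ}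
    (hl : 0 < l) (hld : l < Nat.dist (Λ.part i) (Λ.part j)) :
    symmetrize (bosMonomial K (lower i j l Λ.part) ⊗ₜ[K] thetaProd K Λ.m_le) ∈ lowerSpan K Λ := by
  have hij' : (i : ℕ) < j := hij
  have hd := hld
  rw [Nat.dist] at hd
  have hswap : ∀ k : Fin N, ((j : ℕ) < Λ.m ∨ Λ.m ≤ (i : ℕ)) →
      ((Equiv.swap i j k : ℕ) < Λ.m ↔ (k : ℕ) < Λ.m) := by
    intro k h
    rw [Equiv.swap_apply_def]
    split_ifs with h1 h1
    · subst h1; omega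
    · subst h1; omega
    · rfl
  have hrefl : ∀ hsame : ((j : ℕ) < Λ.m ∨ Λ.m ≤ (i : ℕ)), Λ.part j < Λ.part i →
      Λ.Admissible i j (Nat.dist (Λ.part i) (Λ.part j) - l) →
      symmetrize (bosMonomial K (lower i j l Λ.part) ⊗ₜ[K] thetaProd K Λ.m_le)
        ∈ lowerSpan K Λ := fun hsame hlt hadm => by
    refine symmetrize_rename_mem (σ := Equiv.swap i j) _ (fun k => hswap k hsame) ?_
    rw [← lower_dist_sub_comp_swap hij.ne hlt hld]
    exact symmetrize_lower_mem_of_admissible hadm (by omega)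
  by_cases hj : (j : ℕ) < Λ.m
  · have hlt := Λ.anti i j hij hj
    by_cases h : (l : ℤ) ≤ ((Λ.part i : ℤ) - Λ.part j - 1) / 2
    · exact symmetrize_lower_mem_of_admissible ⟨hij, Or.inl ⟨hj, h⟩⟩ hl
    -- At the midpoint the two parts before the semicolon become equal, so no superpartition `Ω`
    -- arises.
    by_cases h2 : 2 * l = Λ.part i - Λ.part j
    · refine symmetrize_tmul_thetaProd_mem _ _ fun Ω hΩ => ?_
      obtain ⟨hm, σ, hσ, hp⟩ := hΩ
      exfalso
      have hσ' : ∀ k, ((σ.symm k : Fin N) : ℕ) < Λ.m ↔ (k : ℕ) < Λ.m := fun k => by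
        have := hσ (σ.symm k)
        rw [Equiv.apply_symm_apply] at this
        exact this.symm
      have hpi := hp (σ.symm i)
      have hpj := hp (σ.symm j)
      rw [Equiv.apply_symm_apply, lower_of_lt hlt] at hpi hpj
      simp only [Function.update_self, Function.update_of_ne hij.ne] at hpi hpj
      have heq : Ω.part (σ.symm i) = Ω.part (σ.symm j) := by omega
      rcases lt_trichotomy (σ.symm i) (σ.symm j) with h3 | h3 | h3
      · exact (Ω.anti _ _ h3 (by rw [hm, hσ']; exact hj)).ne heq.symm
      · exact hij.ne (σ.symm.injective h3)
      · exact (Ω.anti _ _ h3 (by rw [hm, hσ']; omega)).ne heq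
    · refine hrefl (Or.inl hj) hlt ⟨hij, Or.inl ⟨hj, ?_⟩⟩
      rw [Nat.dist]
      omega
  · by_cases hi : (i : ℕ) < Λ.m
    · refine symmetrize_lower_mem_of_admissible ⟨hij, Or.inr (Or.inl ⟨hi, not_lt.1 hj, ?_⟩)⟩ hl
      rcases abs_cases ((Λ.part i : ℤ) - Λ.part j) with ⟨h1, h2⟩ | ⟨h1, h2⟩ <;> omega
    · have hi := not_lt.1 hi
      have hle := Λ.symm i j hi hij
      by_cases h : (l : ℤ) ≤ ((Λ.part i : ℤ) - Λ.part j) / 2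
      · exact symmetrize_lower_mem_of_admissible ⟨hij, Or.inr (Or.inr ⟨hi, h⟩)⟩ hl
      · refine hrefl (Or.inr hi) (by omega) ⟨hij, Or.inr (Or.inr ⟨hi, ?_⟩)⟩
        rw [Nat.dist]
        omega

lemma symmetrize_lower_mem {Λ : SuperPartition N} {i j : Fin N} {l : ℕ}
    (hl : 0 < l) (hld : l < Nat.dist (Λ.part i) (Λ.part j)) :
    symmetrize (bosMonomial K (lower i j l Λ.part) ⊗ₜ[K] thetaProd K Λ.m_le) ∈ lowerSpan K Λ := by
  rcases lt_trichotomy i j with h | rfl | h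
  · exact symmetrize_lower_mem_of_lt h hl hld
  · simp at hld
  · rw [lower_comm h.ne']
    exact symmetrize_lower_mem_of_lt h hl (by rwa [Nat.dist_comm])

/-- With `n` the distance of the parts, the term `l = 0` contributes `2n` and the correction in
`spread` removes `n`, leaving the diagonal coefficient `n`. -/
lemma symmetrize_spread_sub_mem (Λ : SuperPartition N) (i j : Fin N) :
    symmetrize (spread K i j Λ.part ⊗ₜ[K] thetaProd K Λ.m_le)
      - (Nat.dist (Λ.part i) (Λ.part j) : K) • symmetrize (leadingTerm K Λ) ∈ lowerSpan K Λ := by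
  have hmem := fun l => symmetrize_lower_mem (K := K) (Λ := Λ) (i := i) (j := j) (l := l)
  rw [spread, leadingTerm_eq]
  generalize Nat.dist (Λ.part i) (Λ.part j) = n at *
  cases n with
  | zero => simp
  | succ n =>
    rw [Finset.sum_range_succ', TensorProduct.sub_tmul, TensorProduct.add_tmul,
      TensorProduct.sum_tmul, map_sub, map_add, map_sum, lower_zero]
    simp only [← TensorProduct.smul_tmul', map_smul]
    rw [add_sub_assoc, add_sub_assoc]
    refine Submodule.add_mem _ (Submodule.sum_mem _ fun l hl => Submodule.smul_mem _ _ ?_) ?_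
    · exact hmem _ (Nat.succ_pos l) (by have := Finset.mem_range.1 hl; omega)
    · convert Submodule.zero_mem _ using 1
      generalize symmetrize (bosMonomial K Λ.part ⊗ₜ[K] thetaProd K Λ.m_le) = X
      match_scalars
      ring

lemma two_smul_sum_Ioi {V : Type*} [AddCommGroup V] (Q : Fin N → Fin N → V)
    (hsymm : ∀ i j, Q i j = Q j i) (h0 : ∀ i, Q i i = 0) :
    2 • ∑ i, ∑ j ∈ Finset.Ioi i, Q i j = ∑ i, ∑ j, Q i j := by
  have h1 : ∀ i, ∑ j, Q i j = ∑ j ∈ Finset.Ioi i, Q i j + ∑ j ∈ Finset.Iio i, Q i j := by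
    intro i
    rw [← Finset.sum_union (Finset.disjoint_left.2 fun x hx hx' =>
      lt_asymm (Finset.mem_Ioi.1 hx) (Finset.mem_Iio.1 hx'))]
    symm
    apply Finset.sum_subset (Finset.subset_univ _)
    intro x _ hx
    have : x = i := by
      simp only [Finset.mem_union, Finset.mem_Ioi, Finset.mem_Iio, not_or, not_lt] at hx
      exact le_antisymm hx.1 hx.2
    rw [this, h0]
  have h2 : ∑ i, ∑ j ∈ Finset.Iio i, Q i j = ∑ i, ∑ j ∈ Finset.Ioi i, Q i j := by
    rw [Finset.sum_comm' (t' := Finset.univ) (s' := fun j => Finset.Ioi j) (by simp)]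
    simp only [hsymm]
  simp only [h1, Finset.sum_add_distrib, h2, two_nsmul]

end SuperPoly

end

/-! ### Triangularity of the Hamiltonian. -/

noncomputable section

namespace SuperPoly

variable {K : Type*} [Field K] {N : ℕ}

open SuperPartition

/-- The symmetrization of the result of the pair interactions of all the pairs of variables that
are carried to `(i, j)`. -/
def pairSum (i j : Fin N) (γ : Fin N → ℕ) (w : Ferm K N) : SPoly K N :=
  ∑ σ : Equiv.Perm (Fin N), exchange σ (spread K (σ.symm i) (σ.symm j) γ ⊗ₜ[K] w
    + exchange (Equiv.swap (σ.symm i) (σ.symm j)) (spread K (σ.symm i) (σ.symm j) γ ⊗ₜ[K] w))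

lemma pairSum_comm (i j : Fin N) (γ : Fin N → ℕ) (w : Ferm K N) :
    pairSum i j γ w = pairSum j i γ w := by
  refine Finset.sum_congr rfl fun σ _ => ?_
  rw [spread_comm, Equiv.swap_comm]

lemma pairSum_self (i : Fin N) (γ : Fin N → ℕ) (w : Ferm K N) : pairSum i i γ w = 0 := by
  simp [pairSum, spread_self]

/-- Conjugated by `σ`, the inner swap becomes the outer exchange of `i` and `j`, which fixes the
symmetrization. Every summand thus acquires the shape required by `pairNumerator_add_exchange`. -/
lemma two_smul_symmetrize (i j : Fin N) (x : SPoly K N) :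
    (2 : K) • symmetrize x = ∑ σ : Equiv.Perm (Fin N), exchange σ (x
      + exchange (Equiv.swap (σ.symm i) (σ.symm j)) x) := by
  have h : ∀ σ : Equiv.Perm (Fin N), exchange σ (exchange (Equiv.swap (σ.symm i) (σ.symm j)) x)
      = exchange (Equiv.swap i j) (exchange σ x) := fun σ => by
    rw [exchange_mul, exchange_mul, Equiv.mul_swap_eq_swap_mul, Equiv.apply_symm_apply,
      Equiv.apply_symm_apply]
  simp only [map_add, Finset.sum_add_distrib, h, ← map_sum, ← symmetrize_apply]
  rw [exchange_symmetrize, two_smul]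

lemma two_smul_pair_symmetrize {i j : Fin N} (hij : i ≠ j) (γ : Fin N → ℕ) (w : Ferm K N) :
    (2 : K) • (termB i j (symmetrize (bosMonomial K γ ⊗ₜ[K] w))
      - (2 : K) • termF i j (symmetrize (bosMonomial K γ ⊗ₜ[K] w)))
      = incl (pairSum i j γ w) := by
  set a := algebraMap (Bos K N) (BosFrac K N) ((MvPolynomial.X i - MvPolynomial.X j) ^ 2) with ha
  have ha0 : a ≠ 0 := by
    rw [ha, map_pow]
    exact pow_ne_zero _ (algebraMap_X_sub_ne_zero hij)
  have key : a • ((2 : K) • (termB i j (symmetrize (bosMonomial K γ ⊗ₜ[K] w))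
      - (2 : K) • termF i j (symmetrize (bosMonomial K γ ⊗ₜ[K] w))))
      = a • incl (pairSum i j γ w) := by
    rw [smul_comm, smul_pair_eq_incl hij, ha, ← incl_smul_bos, ← map_smul, ← map_smul,
      two_smul_symmetrize i j, map_sum, pairSum, Finset.smul_sum]
    congr 1
    refine Finset.sum_congr rfl fun σ _ => ?_
    have h1 := exchange_pairNumerator σ (σ.symm i) (σ.symm j) (bosMonomial K γ ⊗ₜ[K] w
      + exchange (Equiv.swap (σ.symm i) (σ.symm j)) (bosMonomial K γ ⊗ₜ[K] w))
    rw [Equiv.apply_symm_apply, Equiv.apply_symm_apply] at h1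
    rw [← h1, pairNumerator_add_exchange (fun h => hij (σ.symm.injective h)), exchange_smul_bos]
    simp only [map_pow, map_sub, MvPolynomial.rename_X, Equiv.apply_symm_apply]
  have := congrArg (fun x => a⁻¹ • x) key
  simpa only [smul_smul, inv_mul_cancel₀ ha0, one_smul] using this

/-- For fixed `σ` the pairs `(σ⁻¹ i, σ⁻¹ j)` run over all pairs; the factor 2 comes from the
exchanged copy. -/
lemma sum_pairSum (γ : Fin N → ℕ) (w : Ferm K N) :
    ∑ i, ∑ j, pairSum i j γ w = 2 • ∑ i, ∑ j, symmetrize (spread K i j γ ⊗ₜ[K] w) := by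
  simp only [pairSum]
  have h1 : ∀ F : Fin N → Fin N → Equiv.Perm (Fin N) → SPoly K N,
      ∑ i, ∑ j, ∑ σ : Equiv.Perm (Fin N), F (σ.symm i) (σ.symm j) σ
        = ∑ i, ∑ j, ∑ σ, F i j σ := by
    intro F
    calc _ = ∑ σ : Equiv.Perm (Fin N), ∑ i, ∑ j, F (σ.symm i) (σ.symm j) σ :=
          (Finset.sum_congr rfl fun i _ => Finset.sum_comm).trans Finset.sum_comm
      _ = ∑ σ : Equiv.Perm (Fin N), ∑ i, ∑ j, F i j σ := by
          refine Finset.sum_congr rfl fun σ _ => ?_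
          rw [← Equiv.sum_comp σ.symm fun i => ∑ j, F i j σ]
          exact Finset.sum_congr rfl fun i _ => Equiv.sum_comp σ.symm fun j => F (σ.symm i) j σ
      _ = _ := Finset.sum_comm.trans (Finset.sum_congr rfl fun i _ => Finset.sum_comm)
  rw [h1 fun i j σ => exchange σ (spread K i j γ ⊗ₜ[K] w
    + exchange (Equiv.swap i j) (spread K i j γ ⊗ₜ[K] w))]
  simp only [← symmetrize_apply, map_add, symmetrize_exchange, Finset.sum_add_distrib, two_nsmul]

lemma sum_termA_symmetrize (γ : Fin N → ℕ) (w : Ferm K N) :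
    ∑ i, termA i (symmetrize (bosMonomial K γ ⊗ₜ[K] w))
      = (∑ i, (γ i : K) ^ 2) • incl (symmetrize (bosMonomial K γ ⊗ₜ[K] w)) := by
  simp only [symmetrize_apply, map_sum]
  rw [Finset.sum_comm, Finset.smul_sum]
  refine Finset.sum_congr rfl fun σ _ => ?_
  rw [exchange_tmul, rename_bosMonomial]
  have h : ∀ i, termA i (bosMonomial K (γ ∘ σ.symm) ⊗ₜ[K] fermPerm σ w)
      = ((γ (σ.symm i) : K) ^ 2) • incl (bosMonomial K (γ ∘ σ.symm) ⊗ₜ[K] fermPerm σ w) := by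
    intro i
    simp only [termA, TensorProduct.map_tmul, LinearMap.comp_apply, euler_bosMonomial, map_smul,
      smul_smul, LinearMap.id_apply, incl_tmul, Function.comp_apply, TensorProduct.smul_tmul', sq]
  simp only [h]
  rw [← Finset.sum_smul, Equiv.sum_comp σ.symm fun i => (γ i : K) ^ 2]

variable [CharZero K]

/-- The 2 of `sum_pairSum` cancels against passing to ordered pairs; the 2 of
`two_smul_pair_symmetrize` remains. -/
lemma two_smul_hamiltonian_symmetrize (β : K) (γ : Fin N → ℕ) (w : Ferm K N) :
    (2 : K) • hamiltonian β (symmetrize (bosMonomial K γ ⊗ₜ[K] w))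
      = incl ((2 * ∑ i, (γ i : K) ^ 2) • symmetrize (bosMonomial K γ ⊗ₜ[K] w)
        + β • ∑ i, ∑ j, symmetrize (spread K i j γ ⊗ₜ[K] w)) := by
  have hA := sum_termA_symmetrize (K := K) γ w
  have hpair : ∑ i, ∑ j ∈ Finset.Ioi i, pairSum i j γ w
      = ∑ i, ∑ j, symmetrize (spread K i j γ ⊗ₜ[K] w) := by
    have h := two_smul_sum_Ioi (fun i j => pairSum i j γ w) (fun i j => pairSum_comm i j γ w)
      (fun i => pairSum_self i γ w)
    rw [sum_pairSum, ← Nat.cast_smul_eq_nsmul K, ← Nat.cast_smul_eq_nsmul K] at h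
    exact smul_right_injective _ (two_ne_zero : ((2 : ℕ) : K) ≠ 0) h
  have hpair' : (2 : K) • (∑ i, ∑ j ∈ Finset.Ioi i,
        termB i j (symmetrize (bosMonomial K γ ⊗ₜ[K] w))
      - (2 : K) • ∑ i, ∑ j ∈ Finset.Ioi i, termF i j (symmetrize (bosMonomial K γ ⊗ₜ[K] w)))
      = incl (∑ i, ∑ j, symmetrize (spread K i j γ ⊗ₜ[K] w)) := by
    rw [← hpair, map_sum]
    simp only [map_sum]
    rw [Finset.smul_sum, ← Finset.sum_sub_distrib, Finset.smul_sum]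
    refine Finset.sum_congr rfl fun i _ => ?_
    rw [Finset.smul_sum, ← Finset.sum_sub_distrib, Finset.smul_sum]
    refine Finset.sum_congr rfl fun j hj => ?_
    exact two_smul_pair_symmetrize (Finset.mem_Ioi.1 hj).ne γ w
  rw [map_add, map_smul, map_smul, ← hpair', mul_smul, ← hA]
  simp only [hamiltonian, LinearMap.sub_apply, LinearMap.add_apply, LinearMap.smul_apply,
    LinearMap.sum_apply]
  module

/-- The Hamiltonian acts triangularly on the monomial superpolynomials. -/
theorem hamiltonian_monomial (β : K) (Λ : SuperPartition N) :
    ∃ v ∈ lowerSpan K Λ,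
      hamiltonian β (monomial K Λ) = incl (Λ.eigenvalue β • monomial K Λ + v) := by
  set y := ∑ i, ∑ j, (symmetrize (spread K i j Λ.part ⊗ₜ[K] thetaProd K Λ.m_le)
      - (Nat.dist (Λ.part i) (Λ.part j) : K) • symmetrize (leadingTerm K Λ)) with hy
  have hmem : y ∈ lowerSpan K Λ := Submodule.sum_mem _ fun i _ => Submodule.sum_mem _ fun j _ =>
    symmetrize_spread_sub_mem Λ i j
  have hy' : ∑ i, ∑ j, symmetrize (spread K i j Λ.part ⊗ₜ[K] thetaProd K Λ.m_le)
      = y + (∑ i, ∑ j, (Nat.dist (Λ.part i) (Λ.part j) : K)) • symmetrize (leadingTerm K Λ) := by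
    rw [hy]
    simp only [Finset.sum_sub_distrib, Finset.sum_smul]
    abel
  have h := two_smul_hamiltonian_symmetrize β Λ.part (thetaProd K Λ.m_le)
  -- The distances from all ordered pairs and the squares of the parts add up to `2 ε_Λ`.
  rw [hy', ← leadingTerm_eq, smul_add, add_left_comm, smul_smul, ← add_smul, ← two_mul_eigenvalue]
    at h
  refine ⟨((Λ.normalization : K)⁻¹ * 2⁻¹ * β) • y, Submodule.smul_mem _ _ hmem, ?_⟩
  have h2 := congrArg (fun x => (2 : K)⁻¹ • x) h
  simp only [smul_smul, inv_mul_cancel₀ (two_ne_zero : (2 : K) ≠ 0), one_smul] at h2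
  rw [monomial_eq, map_smul, h2, ← map_smul, ← map_smul]
  congr 1
  have : (2 : K) ≠ 0 := two_ne_zero
  match_scalars <;> field_simp

end SuperPoly

/-! ### Linear algebra of triangular operators. -/

section Triangular

variable {K V W ι : Type*} [Field K] [AddCommGroup V] [Module K V] [AddCommGroup W] [Module K W]

/-- A triangular operator `T`, relative to an embedding `e`, is surjective on the span of a set of
indices at which its diagonal entries do not vanish. -/
lemma map_span_le_of_triangular (T e : V →ₗ[K] W) (b : ι → V) (d : ι → K) (r : ι → ℕ)
    (S : Set ι) (hd : ∀ i ∈ S, d i ≠ 0)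
    (hT : ∀ i ∈ S, ∃ v ∈ Submodule.span K (b '' {j | j ∈ S ∧ r j < r i}),
      T (b i) = e (d i • b i + v)) :
    (Submodule.span K (b '' S)).map e ≤ (Submodule.span K (b '' S)).map T := by
  -- Induction on the rank: `d i • e (b i) = T (b i) - e v`, where `e v` is already in the image.
  have key : ∀ n, ∀ i ∈ S, r i = n → e (b i) ∈ (Submodule.span K (b '' S)).map T := by
    intro n
    induction n using Nat.strong_induction_on with
    | _ n ih =>
      intro i hi hn
      obtain ⟨v, hv, h⟩ := hT i hi
      have hev : e v ∈ (Submodule.span K (b '' S)).map T := by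
        have : Submodule.span K (b '' {j | j ∈ S ∧ r j < r i})
            ≤ ((Submodule.span K (b '' S)).map T).comap e := by
          rw [Submodule.span_le]
          rintro _ ⟨j, ⟨hj, hlt⟩, rfl⟩
          exact ih _ (hn ▸ hlt) j hj rfl
        exact this hv
      have hTb : T (b i) ∈ (Submodule.span K (b '' S)).map T :=
        Submodule.mem_map_of_mem (Submodule.subset_span ⟨i, hi, rfl⟩)
      rw [h, map_add, map_smul] at hTb
      have := Submodule.sub_mem _ hTb hev
      rw [add_sub_cancel_right] at this
      exact (Submodule.smul_mem_iff _ (hd i hi)).1 this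
  rw [Submodule.map_le_iff_le_comap, Submodule.span_le]
  rintro _ ⟨i, hi, rfl⟩
  exact key _ i hi rfl

/-- A triangular operator with nonvanishing diagonal entries is injective on the span of a finite
set. -/
lemma eq_zero_of_triangular (T e : V →ₗ[K] W) (he : Function.Injective e) (b : ι → V) (d : ι → K)
    (r : ι → ℕ) (S : Set ι) (hS : S.Finite) (hd : ∀ i ∈ S, d i ≠ 0)
    (hT : ∀ i ∈ S, ∃ v ∈ Submodule.span K (b '' {j | j ∈ S ∧ r j < r i}),
      T (b i) = e (d i • b i + v)) {x : V} (hx : x ∈ Submodule.span K (b '' S)) (h0 : T x = 0) :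
    x = 0 := by
  have hle := map_span_le_of_triangular T e b d r S hd hT
  set U := Submodule.span K (b '' S)
  have : FiniteDimensional K U := FiniteDimensional.span_of_finite K (hS.image b)
  -- Independence of the `b i` is not needed: `dim U = dim e(U) ≤ dim T(U)` forces the kernel of `T`
  -- on `U` to vanish.
  have h1 : Module.finrank K (U.map e) = Module.finrank K U :=
    (Submodule.equivMapOfInjective e he U).finrank_eq.symm
  have h2 : Module.finrank K (U.map e) ≤ Module.finrank K (U.map T) :=
    Submodule.finrank_mono hle
  have h3 := LinearMap.finrank_range_add_finrank_ker (T.domRestrict U)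
  rw [LinearMap.range_domRestrict] at h3
  have h4 : Module.finrank K (LinearMap.ker (T.domRestrict U)) = 0 := by omega
  have h5 := Submodule.finrank_eq_zero.1 h4
  have h6 : (⟨x, hx⟩ : U) ∈ LinearMap.ker (T.domRestrict U) := h0
  rw [h5, Submodule.mem_bot] at h6
  exact congrArg Subtype.val h6

end Triangular

/-! ### Existence and uniqueness. -/

namespace SuperPoly

variable {K : Type*} [Field K] {N : ℕ}

open SuperPartition

lemma span_setOf_eq {p : SuperPartition N → Prop} :
    Submodule.span K {g : SPoly K N | ∃ Ω : SuperPartition N, p Ω ∧ g = monomial K Ω}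
      = Submodule.span K (monomial K '' {Ω | p Ω}) := by
  congr 1
  ext g
  exact ⟨fun ⟨Ω, h, e⟩ => ⟨Ω, h, e.symm⟩, fun ⟨Ω, h, e⟩ => ⟨Ω, h, e.symm⟩⟩

lemma lowerSpan_le {S : Set (SuperPartition N)} (hS : ∀ Ω ∈ S, ∀ Γ : SuperPartition N,
    Γ.SLT Ω → Γ ∈ S) {Ω : SuperPartition N} (hΩ : Ω ∈ S) :
    lowerSpan K Ω ≤ Submodule.span K (monomial K ''
      {Γ | Γ ∈ S ∧ ∑ i, Γ.star i ^ 2 < ∑ i, Ω.star i ^ 2}) := by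
  apply Submodule.span_mono
  rintro _ ⟨Γ, hΓ, rfl⟩
  exact ⟨Γ, ⟨hS Ω hΩ Γ hΓ, hΓ.dominanceLT.sum_sq_lt Γ.star_antitone⟩, rfl⟩

lemma IsJackS.isJackDominance {β : K} {Λ : SuperPartition N} {J : SPoly K N}
    (h : IsJackS β Λ J) : IsJackDominance β Λ J := by
  refine ⟨Submodule.span_mono ?_ h.1, h.2⟩
  rintro _ ⟨Ω, hΩ, rfl⟩
  exact ⟨Ω, hΩ.dominanceLT, rfl⟩

variable [CharZero K]

/-- Stated for any set closed downward under `<^s`, so that it serves both the step-order set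
(existence) and the dominance set (uniqueness). -/
lemma triangular_shifted (β : K) (Λ : SuperPartition N) {S : Set (SuperPartition N)}
    (hS : ∀ Ω ∈ S, ∀ Γ : SuperPartition N, Γ.SLT Ω → Γ ∈ S) :
    ∀ Ω ∈ S, ∃ v ∈ Submodule.span K (monomial K ''
        {Γ | Γ ∈ S ∧ ∑ i, Γ.star i ^ 2 < ∑ i, Ω.star i ^ 2}),
      (hamiltonian β - Λ.eigenvalue β • incl : SPoly K N →ₗ[K] SRat K N) (monomial K Ω)
        = incl ((Ω.eigenvalue β - Λ.eigenvalue β) • monomial K Ω + v) := by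
  intro Ω hΩ
  obtain ⟨v, hv, h⟩ := hamiltonian_monomial β Ω
  refine ⟨v, lowerSpan_le hS hΩ hv, ?_⟩
  rw [LinearMap.sub_apply, LinearMap.smul_apply, h, ← map_smul, ← map_sub]
  congr 1
  module

lemma exists_isJackS {β : K} (hβ : ∀ q : ℚ, q < 0 → β ≠ (q : K)) (Λ : SuperPartition N) :
    ∃ J : SPoly K N, IsJackS β Λ J := by
  obtain ⟨v, hv, h⟩ := hamiltonian_monomial β Λ
  have hle := map_span_le_of_triangular (hamiltonian β - Λ.eigenvalue β • incl) incl (monomial K)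
    (fun Ω => Ω.eigenvalue β - Λ.eigenvalue β) (fun Ω => ∑ i, Ω.star i ^ 2) {Ω | Ω.SLT Λ}
    (fun Ω hΩ => sub_ne_zero.2 (eigenvalue_ne hβ (SLT.dominanceLT hΩ)))
    (triangular_shifted β Λ fun Ω hΩ Γ hΓ => hΓ.trans hΩ)
  rw [lowerSpan, span_setOf_eq] at hv
  -- Here `(H - ε_Λ) u = v = (H - ε_Λ) m_Λ`, so `m_Λ - u` is an eigenvector.
  obtain ⟨u, hu, hu'⟩ := hle (Submodule.mem_map_of_mem hv)
  refine ⟨monomial K Λ - u, ?_, ?_⟩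
  · rw [span_setOf_eq, sub_sub_cancel_left]
    exact Submodule.neg_mem _ hu
  · rw [LinearMap.sub_apply, LinearMap.smul_apply] at hu'
    rw [IsEigen, map_sub, map_sub, h, map_add, ← hu', map_smul]
    module

lemma IsJackDominance.unique {β : K} (hβ : ∀ q : ℚ, q < 0 → β ≠ (q : K)) {Λ : SuperPartition N}
    {J J' : SPoly K N} (h : IsJackDominance β Λ J) (h' : IsJackDominance β Λ J') : J = J' := by
  have hmem := Submodule.sub_mem _ h.1 h'.1
  rw [sub_sub_sub_cancel_right, span_setOf_eq] at hmem
  refine sub_eq_zero.1 (eq_zero_of_triangular (hamiltonian β - Λ.eigenvalue β • incl) incl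
    incl_injective (monomial K) (fun Ω => Ω.eigenvalue β - Λ.eigenvalue β)
    (fun Ω => ∑ i, Ω.star i ^ 2) _ (finite_dominanceLT Λ)
    (fun Ω hΩ => sub_ne_zero.2 (eigenvalue_ne hβ hΩ))
    (triangular_shifted β Λ fun Ω hΩ Γ hΓ => hΓ.dominanceLT.star_trans hΩ) hmem ?_)
  rw [LinearMap.sub_apply, LinearMap.smul_apply, map_sub, map_sub, h.2, h'.2]
  module

end SuperPoly

end

theorem theorem10 {K : Type*} [Field K] [CharZero K] (β : K)
    (hβ : ∀ q : ℚ, q < 0 → β ≠ (q : K)) {N : ℕ} (Λ : SuperPartition N) :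
    (∃! J : SuperPoly.SPoly K N, SuperPoly.IsJackS β Λ J) ∧
    (∃! J : SuperPoly.SPoly K N, SuperPoly.IsJackDominance β Λ J) ∧
    (∀ J : SuperPoly.SPoly K N,
      SuperPoly.IsJackS β Λ J ↔ SuperPoly.IsJackDominance β Λ J) := by
  obtain ⟨J, hJ⟩ := SuperPoly.exists_isJackS hβ Λ
  have huniq : ∀ J', SuperPoly.IsJackDominance β Λ J' → J' = J := fun J' hJ' =>
    hJ'.unique hβ hJ.isJackDominance
  exact ⟨⟨J, hJ, fun J' hJ' => huniq J' hJ'.isJackDominance⟩, ⟨J, hJ.isJackDominance, huniq⟩,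
    fun J' => ⟨fun h => h.isJackDominance, fun h => huniq J' h ▸ hJ⟩⟩
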